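/- **Theorem (the Andrews–Uncu Conjecture is true).** For $A,q\in\mathbb{C}$ and $n\ge 0$ write $(A;q)_n=\prod_{k=0}^{n-1}(1-Aq^k)$, and, for $|q|<1$, $(A;q)_\infty=\prod_{k=0}^{\infty}(1-Aq^k)$ and $(A_1,A_2;q)_\infty=(A_1;q)_\infty(A_2;q)_\infty$. Let $q$ be a complex number with $|q|<1$. Then the infinite products $(q^2;q^6)_\infty$ and $(q^3;q^6)_\infty$ converge and are nonzero, the double series below converges absolutely, and $$\sum_{m,n\ge0}\frac{(-1)^n\,q^{2\binom m2+9\binom n2+3mn+2m+7n}}{(q;q)_m\,(q^3;q^3)_n}=\frac{1}{(q^2,q^3;q^6)_\infty}.$$ (Here $0^0=1$, so that for $q=0$ both sides equal $1$.) -/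

import Mathlib

/-- The finite `q`-Pochhammer symbol `(A; q)_n = ∏_{k=0}^{n-1} (1 - A q^k)`. -/
noncomputable def qPoch (A q : ℂ) (n : ℕ) : ℂ :=
  ∏ k ∈ Finset.range n, (1 - A * q ^ k)

/-- The infinite `q`-Pochhammer symbol `(A; q)_∞ = ∏_{k ≥ 0} (1 - A q^k)`. -/
noncomputable def qPochInf (A q : ℂ) : ℂ :=
  ∏' k : ℕ, (1 - A * q ^ k)

/-- The two-parameter symbol `(A₁, A₂; q)_∞ = (A₁; q)_∞ (A₂; q)_∞`. -/
noncomputable def qPochInf₂ (A₁ A₂ q : ℂ) : ℂ :=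
  qPochInf A₁ q * qPochInf A₂ q

open Filter Topology

/-! ### Finite and infinite `q`-Pochhammer symbols -/

/-! Choose `p` with `p ^ 3 = q` and a primitive cube root of unity `ω`. A theta series in base p³ at
p⁴, equal to -p⁻¹ (p;p)_∞ by the Jacobi triple product, is multiplied by the double series `∑
pairTerm`. Writing the theta index as M + m + k gives a triple series whose terms depend on p only
through q, apart from a factor p^(4M) (`thetaTerm_mul_pairTerm`). Adding its values at p, ωp, ω²p
keeps only the terms with 3 ∣ M. For M = 3n, Euler's expansion sums k to (q^(3n+3);q³)_∞, which is 0
for n < 0 and (q³;q³)_∞ / (q³;q³)_n for n ≥ 0. What remains is 3 (q³;q³)_∞ times the required series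
(`hasSum_doubleSeries`).

The triple series is also a product. Summing m in `pairTerm` leaves `∑ phiTerm`. Pairing its
consecutive terms gives F(b) = `∑ wzTerm` in base p⁶ at b = p⁻¹, and a WZ-type certificate yields a
first order recurrence from b to bq, which is iterated towards b = 0 (`tsum_wzTerm`). Hence
`tripleSum p` is a function of q times p⁻¹ (p;p)_∞ (p²;p²)_∞ (`tripleSum_mul`).

It remains to add that expression over the three cube roots (`trisection`). By Gauss, 2 (p;p)_∞
(p²;p²)_∞ = ∑ (-1)^i p^(i² + j(j-1)/2). The exponents congruent to 1 mod 3 come from two classes of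
(i, j), each summing to 0 by a sign-reversing symmetry. The two classes overlap in a copy of the
whole series in base p⁹, so inclusion-exclusion leaves a single product. -/

theorem qPoch_succ (A q : ℂ) (n : ℕ) : qPoch A q (n + 1) = qPoch A q n * (1 - A * q ^ n) :=
  Finset.prod_range_succ _ _

theorem qPoch_succ' (A q : ℂ) (n : ℕ) : qPoch A q (n + 1) = (1 - A) * qPoch (A * q) q n := by
  rw [qPoch, Finset.prod_range_succ', mul_comm]
  simp only [pow_zero, mul_one, qPoch]
  congr 1
  exact Finset.prod_congr rfl fun k _ => by ring

theorem qPoch_add (A q : ℂ) (m n : ℕ) :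
    qPoch A q (m + n) = qPoch A q m * qPoch (A * q ^ m) q n := by
  simp only [qPoch, Finset.prod_range_add]
  congr 1
  exact Finset.prod_congr rfl fun k _ => by ring

theorem qPoch_two_mul (A q : ℂ) (n : ℕ) :
    qPoch A q (2 * n) = qPoch A (q ^ 2) n * qPoch (A * q) (q ^ 2) n := by
  induction n with
  | zero => simp [qPoch]
  | succ n ih =>
    rw [show 2 * (n + 1) = 2 * n + 1 + 1 by ring, qPoch_succ, qPoch_succ, ih, qPoch_succ,
      qPoch_succ]
    ring

theorem qPoch_three_mul (A q : ℂ) (n : ℕ) :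
    qPoch A q (3 * n)
      = qPoch A (q ^ 3) n * qPoch (A * q) (q ^ 3) n * qPoch (A * q ^ 2) (q ^ 3) n := by
  induction n with
  | zero => simp [qPoch]
  | succ n ih =>
    rw [show 3 * (n + 1) = 3 * n + 1 + 1 + 1 by ring, qPoch_succ, qPoch_succ, qPoch_succ, ih,
      qPoch_succ, qPoch_succ, qPoch_succ]
    ring

theorem norm_pow_lt_one {q : ℂ} (hq : ‖q‖ < 1) {n : ℕ} (hn : n ≠ 0) : ‖q ^ n‖ < 1 := by
  rw [norm_pow]
  exact pow_lt_one₀ (norm_nonneg _) hq hn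

theorem one_sub_ne_zero_of_norm_lt {z : ℂ} (hz : ‖z‖ < 1) : 1 - z ≠ 0 := by
  intro h
  rw [← sub_eq_zero.mp h] at hz
  simp at hz

theorem summable_norm_neg_mul_pow (A : ℂ) {q : ℂ} (hq : ‖q‖ < 1) :
    Summable fun k : ℕ => ‖-(A * q ^ k)‖ := by
  simp only [norm_neg, norm_mul, norm_pow]
  exact (summable_geometric_of_lt_one (norm_nonneg _) hq).mul_left _

theorem multipliable_qPoch (A : ℂ) {q : ℂ} (hq : ‖q‖ < 1) :
    Multipliable fun k : ℕ => 1 - A * q ^ k := by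
  simpa [sub_eq_add_neg] using multipliable_one_add_of_summable (summable_norm_neg_mul_pow A hq)

theorem tendsto_qPoch (A : ℂ) {q : ℂ} (hq : ‖q‖ < 1) :
    Tendsto (qPoch A q) atTop (𝓝 (qPochInf A q)) :=
  (multipliable_qPoch A hq).tendsto_prod_tprod_nat

theorem qPochInf_ne_zero {A q : ℂ} (hq : ‖q‖ < 1) (h : ∀ k : ℕ, 1 - A * q ^ k ≠ 0) :
    qPochInf A q ≠ 0 := by
  have := tprod_one_add_ne_zero_of_summable (f := fun k : ℕ => -(A * q ^ k))
    (fun k => by simpa [sub_eq_add_neg] using h k) (summable_norm_neg_mul_pow A hq)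
  simpa [qPochInf, sub_eq_add_neg] using this

theorem one_sub_mul_pow_ne_zero {A q : ℂ} (hA : ‖A‖ < 1) (hq : ‖q‖ < 1) (k : ℕ) :
    1 - A * q ^ k ≠ 0 := by
  refine one_sub_ne_zero_of_norm_lt ?_
  rw [norm_mul, norm_pow]
  exact mul_lt_one_of_nonneg_of_lt_one_left (norm_nonneg _) hA
    (pow_le_one₀ (norm_nonneg _) hq.le)

theorem qPochInf_ne_zero_of_norm_lt {A q : ℂ} (hA : ‖A‖ < 1) (hq : ‖q‖ < 1) :
    qPochInf A q ≠ 0 :=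
  qPochInf_ne_zero hq (one_sub_mul_pow_ne_zero hA hq)

theorem qPoch_ne_zero_of_norm_lt {A q : ℂ} (hA : ‖A‖ < 1) (hq : ‖q‖ < 1) (n : ℕ) :
    qPoch A q n ≠ 0 :=
  Finset.prod_ne_zero_iff.mpr fun k _ => one_sub_mul_pow_ne_zero hA hq k

theorem qPoch_mul_qPochInf (A : ℂ) {q : ℂ} (hq : ‖q‖ < 1) (n : ℕ) :
    qPoch A q n * qPochInf (A * q ^ n) q = qPochInf A q := by
  have h1 : Tendsto (fun m => qPoch A q (n + m)) atTop (𝓝 (qPochInf A q)) := by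
    simpa only [add_comm n] using (tendsto_add_atTop_iff_nat n).mpr (tendsto_qPoch A hq)
  simp only [qPoch_add] at h1
  exact tendsto_nhds_unique ((tendsto_qPoch _ hq).const_mul _) h1

theorem one_sub_mul_qPochInf (A : ℂ) {q : ℂ} (hq : ‖q‖ < 1) :
    (1 - A) * qPochInf (A * q) q = qPochInf A q := by
  simpa [qPoch] using qPoch_mul_qPochInf A hq 1

theorem qPochInf_eq_zero {A q : ℂ} (n : ℕ) (hn : A * q ^ n = 1) : qPochInf A q = 0 :=
  tprod_of_exists_eq_zero ⟨n, by simp [hn]⟩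

theorem qPochInf_sq (A : ℂ) {q : ℂ} (hq : ‖q‖ < 1) :
    qPochInf A (q ^ 2) * qPochInf (A * q) (q ^ 2) = qPochInf A q := by
  have h2 := norm_pow_lt_one hq two_ne_zero
  have h1 := (tendsto_qPoch A hq).comp (tendsto_id.const_mul_atTop' (r := 2) (by norm_num))
  simp only [Function.comp_def, id, qPoch_two_mul] at h1
  exact tendsto_nhds_unique ((tendsto_qPoch _ h2).mul (tendsto_qPoch _ h2)) h1

theorem qPochInf_cube (A : ℂ) {q : ℂ} (hq : ‖q‖ < 1) :
    qPochInf A (q ^ 3) * qPochInf (A * q) (q ^ 3) * qPochInf (A * q ^ 2) (q ^ 3)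
      = qPochInf A q := by
  have h2 := norm_pow_lt_one hq three_ne_zero
  have h1 := (tendsto_qPoch A hq).comp (tendsto_id.const_mul_atTop' (r := 3) (by norm_num))
  simp only [Function.comp_def, id, qPoch_three_mul] at h1
  exact tendsto_nhds_unique
    (((tendsto_qPoch _ h2).mul (tendsto_qPoch _ h2)).mul (tendsto_qPoch _ h2)) h1

theorem pow_le_norm_qPoch {A q : ℂ} {δ : ℝ} (hδ : 0 ≤ δ) (h : ∀ k : ℕ, δ ≤ ‖1 - A * q ^ k‖)
    (n : ℕ) : δ ^ n ≤ ‖qPoch A q n‖ := by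
  rw [qPoch, norm_prod]
  calc δ ^ n = ∏ _k ∈ Finset.range n, δ := by simp
    _ ≤ _ := Finset.prod_le_prod (fun _ _ => hδ) fun k _ => h k

theorem norm_qPoch_le {A q : ℂ} (hq : ‖q‖ ≤ 1) (n : ℕ) : ‖qPoch A q n‖ ≤ (1 + ‖A‖) ^ n := by
  rw [qPoch, norm_prod]
  calc _ ≤ ∏ _k ∈ Finset.range n, (1 + ‖A‖) := by
        refine Finset.prod_le_prod (fun _ _ => norm_nonneg _) fun k _ => ?_
        refine (norm_sub_le _ _).trans ?_
        rw [norm_one, norm_mul, norm_pow]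
        gcongr
        exact mul_le_of_le_one_right (norm_nonneg _) (pow_le_one₀ (norm_nonneg _) hq)
    _ = _ := by simp

theorem norm_inv_qPoch_le {A q : ℂ} (hA : ‖A‖ < 1) (hq : ‖q‖ < 1) (n : ℕ) :
    ‖(qPoch A q n)⁻¹‖ ≤ ((1 - ‖A‖)⁻¹) ^ n := by
  rw [norm_inv, inv_pow]
  have h0 : 0 < 1 - ‖A‖ := by linarith
  refine inv_anti₀ (pow_pos h0 n) (pow_le_norm_qPoch h0.le (fun k => ?_) n)
  have h1 : ‖A * q ^ k‖ ≤ ‖A‖ := by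
    rw [norm_mul, norm_pow]
    exact mul_le_of_le_one_right (norm_nonneg _) (pow_le_one₀ (norm_nonneg _) hq.le)
  have h2 := norm_sub_norm_le (1 : ℂ) (A * q ^ k)
  rw [norm_one] at h2
  linarith

/-! ### Growth estimates -/

/-- The quadratic exponent beats every geometric factor, so crude exponential bounds on Pochhammer
symbols suffice wherever this majorant applies. -/
theorem summable_pow_choose_mul_pow {r : ℝ} (hr0 : 0 ≤ r) (hr : r < 1) (C : ℝ) :
    Summable fun m : ℕ => r ^ m.choose 2 * C ^ m := by
  refine summable_of_ratio_norm_eventually_le (r := 1 / 2) (by norm_num) ?_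
  have h1 : Tendsto (fun m : ℕ => r ^ m * |C|) atTop (𝓝 (0 * |C|)) :=
    (tendsto_pow_atTop_nhds_zero_of_lt_one hr0 hr).mul_const _
  rw [zero_mul] at h1
  filter_upwards [h1.eventually (ge_mem_nhds (show (0 : ℝ) < 1 / 2 by norm_num))] with m hm
  have h2 : (m + 1).choose 2 = m.choose 2 + m := by
    rw [Nat.choose_succ_succ' m 1, Nat.choose_one_right, add_comm]
  rw [h2, norm_mul, norm_mul, norm_pow, norm_pow, norm_pow, norm_pow, Real.norm_eq_abs,
    Real.norm_eq_abs, abs_of_nonneg hr0]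
  calc r ^ (m.choose 2 + m) * |C| ^ (m + 1) = (r ^ m * |C|) * (r ^ m.choose 2 * |C| ^ m) := by ring
    _ ≤ _ := by gcongr

/-! ### Euler's two expansions -/

theorem norm_euler_term_le {q : ℂ} (hq : ‖q‖ < 1) (z : ℂ) (m : ℕ) :
    ‖(-1) ^ m * q ^ m.choose 2 * z ^ m / qPoch q q m‖
      ≤ ‖q‖ ^ m.choose 2 * (‖z‖ * (1 - ‖q‖)⁻¹) ^ m := by
  rw [div_eq_mul_inv, norm_mul, norm_mul, norm_mul, norm_pow, norm_pow, norm_pow, norm_neg,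
    norm_one, one_pow, one_mul, mul_pow, ← mul_assoc]
  gcongr
  exact norm_inv_qPoch_le hq hq m

theorem summable_norm_euler {q : ℂ} (hq : ‖q‖ < 1) (z : ℂ) :
    Summable fun m : ℕ => ‖(-1) ^ m * q ^ m.choose 2 * z ^ m / qPoch q q m‖ :=
  Summable.of_nonneg_of_le (fun _ => norm_nonneg _) (norm_euler_term_le hq z)
    (summable_pow_choose_mul_pow (norm_nonneg _) hq _)

/-- The value at `z q ^ n` of a power series that converges absolutely at `z` tends to its
constant coefficient. -/
theorem tendsto_tsum_mul_pow_geometric {a : ℕ → ℂ} {q z : ℂ} (hq : ‖q‖ < 1)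
    (h : Summable fun m => ‖a m * z ^ m‖) :
    Tendsto (fun n : ℕ => ∑' m, a m * (z * q ^ n) ^ m) atTop (𝓝 (a 0)) := by
  have h0 : ∑' m : ℕ, (if m = 0 then a 0 else 0) = a 0 := tsum_ite_eq 0 _
  rw [← h0]
  refine tendsto_tsum_of_dominated_convergence h (fun m => ?_) (Eventually.of_forall fun n m => ?_)
  · rcases Nat.eq_zero_or_pos m with rfl | hm
    · simp
    · rw [if_neg hm.ne']
      have h1 : Tendsto (fun n : ℕ => (z * q ^ n) ^ m) atTop (𝓝 ((z * 0) ^ m)) :=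
        ((tendsto_pow_atTop_nhds_zero_of_norm_lt_one hq).const_mul z).pow m
      simpa [hm.ne'] using h1.const_mul (a m)
  · rw [mul_pow, ← mul_assoc, norm_mul]
    refine mul_le_of_le_one_right (norm_nonneg _) ?_
    rw [norm_pow, norm_pow]
    exact pow_le_one₀ (by positivity) (pow_le_one₀ (norm_nonneg _) hq.le)

/-- Euler: `∑ (-1)^m q^(m choose 2) z^m / (q;q)_m = (z;q)_∞`. -/
theorem hasSum_euler {q : ℂ} (hq : ‖q‖ < 1) (z : ℂ) :
    HasSum (fun m : ℕ => (-1) ^ m * q ^ m.choose 2 * z ^ m / qPoch q q m) (qPochInf z q) := by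
  set a : ℕ → ℂ := fun m => (-1) ^ m * q ^ m.choose 2 / qPoch q q m with ha
  have hform : ∀ z : ℂ, ∀ m : ℕ,
      (-1) ^ m * q ^ m.choose 2 * z ^ m / qPoch q q m = a m * z ^ m := fun z m => by
    rw [ha]; ring
  have hsn : ∀ z : ℂ, Summable fun m => ‖a m * z ^ m‖ := fun z => by
    simpa only [hform] using summable_norm_euler hq z
  have hs : ∀ z : ℂ, Summable fun m => a m * z ^ m := fun z => (hsn z).of_norm
  have ha0 : a 0 = 1 := by simp [ha, qPoch]
  have hrec : ∀ m, a (m + 1) * (1 - q ^ (m + 1)) = -(a m * q ^ m) := fun m => by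
    have h1 := qPoch_ne_zero_of_norm_lt hq hq m
    have h2 := one_sub_mul_pow_ne_zero hq hq m
    have h3 : (m + 1).choose 2 = m.choose 2 + m := by
      rw [Nat.choose_succ_succ' m 1, Nat.choose_one_right, add_comm]
    simp only [ha, h3, qPoch_succ, pow_succ, pow_add] at *
    have h4 : 1 - q ^ m * q ≠ 0 := by rwa [mul_comm]
    field_simp
  -- The coefficient recurrence is the functional equation f(z) = (1 - z) f(zq). Iterating it, with
  -- f(z qⁿ) → f(0) = 1, produces the infinite product.
  have hfun : ∀ z : ℂ, ∑' m, a m * z ^ m = (1 - z) * ∑' m, a m * (z * q) ^ m := fun z => by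
    rw [sub_mul, one_mul, ← tsum_mul_left]
    have e1 := (hs z).tsum_eq_zero_add
    have e2 := (hs (z * q)).tsum_eq_zero_add
    have s1 := (summable_nat_add_iff 1).mpr (hs z)
    have s2 := (summable_nat_add_iff 1).mpr (hs (z * q))
    have e3 : ∑' m, z * (a m * (z * q) ^ m)
        = ∑' m, (a (m + 1) * (z * q) ^ (m + 1) - a (m + 1) * z ^ (m + 1)) := by
      refine tsum_congr fun m => ?_
      have := hrec m
      rw [mul_pow, mul_pow]
      linear_combination z ^ (m + 1) * this
    rw [e3, s2.tsum_sub s1, e1, e2]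
    ring
  have hiter : ∀ n : ℕ, ∑' m, a m * z ^ m = qPoch z q n * ∑' m, a m * (z * q ^ n) ^ m := by
    intro n
    induction n with
    | zero => simp [qPoch]
    | succ n ih => rw [ih, hfun (z * q ^ n), qPoch_succ, pow_succ]; ring_nf
  have hlim := (tendsto_qPoch z hq).mul (tendsto_tsum_mul_pow_geometric hq (hsn z))
  simp only [← hiter, ha0, mul_one] at hlim
  have : ∑' m, a m * z ^ m = qPochInf z q := tendsto_nhds_unique tendsto_const_nhds hlim
  simp only [hform]
  rw [← this]
  exact (hs z).hasSum

theorem summable_norm_euler_inv {q z : ℂ} (hq : ‖q‖ < 1) (hz : ‖z‖ < 1) :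
    Summable fun m : ℕ => ‖z ^ m / qPoch q q m‖ := by
  -- With no quadratic exponent here, a geometric bound on 1/(q;q)_m would not cover all |z| < 1. A
  -- uniform bound holds because (q;q)_m has a nonzero limit.
  have hlow : ∃ δ > 0, ∀ m, δ ≤ ‖qPoch q q m‖ := by
    have hlim := (tendsto_qPoch q hq).norm
    have hpos : 0 < ‖qPochInf q q‖ := norm_pos_iff.mpr (qPochInf_ne_zero_of_norm_lt hq hq)
    have hinv := hlim.inv₀ hpos.ne'
    obtain ⟨B, hB⟩ := hinv.bddAbove_range
    have hB0 : 0 < B := lt_of_lt_of_le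
      (inv_pos.mpr (norm_pos_iff.mpr (qPoch_ne_zero_of_norm_lt hq hq 0))) (hB ⟨0, rfl⟩)
    refine ⟨B⁻¹, inv_pos.mpr hB0, fun m => ?_⟩
    exact inv_le_of_inv_le₀ (norm_pos_iff.mpr (qPoch_ne_zero_of_norm_lt hq hq m)) (hB ⟨m, rfl⟩)
  obtain ⟨δ, hδ, h⟩ := hlow
  refine Summable.of_nonneg_of_le (fun _ => norm_nonneg _) (fun m => ?_)
    ((summable_geometric_of_lt_one (norm_nonneg z) hz).mul_right δ⁻¹)
  rw [div_eq_mul_inv, norm_mul, norm_pow, norm_inv]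
  gcongr
  exact h m

/-- Euler: `∑ z^m / (q;q)_m = 1 / (z;q)_∞` for `|z| < 1`. -/
theorem hasSum_euler_inv {q z : ℂ} (hq : ‖q‖ < 1) (hz : ‖z‖ < 1) :
    HasSum (fun m : ℕ => z ^ m / qPoch q q m) (qPochInf z q)⁻¹ := by
  set a : ℕ → ℂ := fun m => (qPoch q q m)⁻¹ with ha
  have hform : ∀ z : ℂ, ∀ m : ℕ, z ^ m / qPoch q q m = a m * z ^ m := fun z m => by
    rw [ha, div_eq_mul_inv, mul_comm]
  have hsn : ∀ z : ℂ, ‖z‖ < 1 → Summable fun m => ‖a m * z ^ m‖ := fun z hz => by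
    simpa only [hform] using summable_norm_euler_inv hq hz
  have hs : ∀ z : ℂ, ‖z‖ < 1 → Summable fun m => a m * z ^ m := fun z hz => (hsn z hz).of_norm
  have ha0 : a 0 = 1 := by simp [ha, qPoch]
  have hrec : ∀ m, a (m + 1) * (1 - q ^ (m + 1)) = a m := fun m => by
    have h1 := qPoch_ne_zero_of_norm_lt hq hq m
    have h2 := one_sub_mul_pow_ne_zero hq hq m
    simp only [ha, qPoch_succ, pow_succ] at *
    have h4 : 1 - q ^ m * q ≠ 0 := by rwa [mul_comm]
    field_simp
  have hzq : ∀ n : ℕ, ‖z * q ^ n‖ < 1 := fun n => by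
    rw [norm_mul, norm_pow]
    exact mul_lt_one_of_nonneg_of_lt_one_left (norm_nonneg _) hz (pow_le_one₀ (norm_nonneg _) hq.le)
  have hfun : ∀ z : ℂ, ‖z‖ < 1 → ‖z * q‖ < 1 →
      (1 - z) * ∑' m, a m * z ^ m = ∑' m, a m * (z * q) ^ m := fun z hz hzq => by
    rw [sub_mul, one_mul, ← tsum_mul_left]
    have e1 := (hs z hz).tsum_eq_zero_add
    have e2 := (hs (z * q) hzq).tsum_eq_zero_add
    have s1 := (summable_nat_add_iff 1).mpr (hs z hz)
    have s2 := (summable_nat_add_iff 1).mpr (hs (z * q) hzq)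
    have e3 : ∑' m, z * (a m * z ^ m)
        = ∑' m, (a (m + 1) * z ^ (m + 1) - a (m + 1) * (z * q) ^ (m + 1)) := by
      refine tsum_congr fun m => ?_
      have := hrec m
      rw [mul_pow]
      linear_combination (-z ^ (m + 1)) * this
    rw [e3, s1.tsum_sub s2, e1, e2]
    ring
  have hiter : ∀ n : ℕ, qPoch z q n * ∑' m, a m * z ^ m = ∑' m, a m * (z * q ^ n) ^ m := by
    intro n
    induction n with
    | zero => simp [qPoch]
    | succ n ih =>
      have h1 : ‖z * q ^ n * q‖ < 1 := by simpa [pow_succ, mul_assoc] using hzq (n + 1)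
      rw [qPoch_succ, mul_right_comm, ih, mul_comm, hfun (z * q ^ n) (hzq n) h1, pow_succ,
        mul_assoc]
  have hlim := (tendsto_qPoch z hq).mul_const (∑' m, a m * z ^ m)
  simp only [hiter] at hlim
  have h1 := tendsto_nhds_unique hlim (tendsto_tsum_mul_pow_geometric hq (hsn z hz))
  have : ∑' m, a m * z ^ m = (qPochInf z q)⁻¹ := by
    rw [ha0] at h1
    exact eq_inv_of_mul_eq_one_right h1
  simp only [hform]
  rw [← this]
  exact (hs z hz).hasSum

/-! ### Theta series and the Jacobi triple product -/

/-- The triangular number `n(n-1)/2` of an integer. -/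
def tri (n : ℤ) : ℤ := n * (n - 1) / 2

theorem two_mul_tri (n : ℤ) : 2 * tri n = n * (n - 1) := by
  refine Int.mul_ediv_cancel' ?_
  rcases Int.even_or_odd n with h | h
  · exact h.two_dvd.mul_right _
  · exact (h.sub_odd odd_one).two_dvd.mul_left _

theorem tri_add (a b : ℤ) : tri (a + b) = tri a + tri b + a * b := by
  linarith [two_mul_tri (a + b), two_mul_tri a, two_mul_tri b]

theorem tri_natCast (n : ℕ) : tri n = (n.choose 2 : ℕ) := by
  induction n with
  | zero => simp [tri]
  | succ n ih =>
    rw [Nat.cast_succ, tri_add, ih, Nat.choose_succ_succ', Nat.choose_one_right]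
    have : tri 1 = 0 := rfl
    push_cast
    linarith

theorem tri_neg (n : ℤ) : tri (-n) = tri n + n := by
  linarith [two_mul_tri (-n), two_mul_tri n]

theorem zpow_tri_natCast (q : ℂ) (n : ℕ) : q ^ tri n = q ^ n.choose 2 := by
  rw [tri_natCast, zpow_natCast]

/-- The general term of the theta series. -/
noncomputable def thetaTerm (q z : ℂ) (n : ℤ) : ℂ := (-1) ^ n * q ^ tri n * z ^ n

theorem summable_norm_thetaTerm {q : ℂ} (hq0 : q ≠ 0) (hq : ‖q‖ < 1) (z : ℂ) :
    Summable fun n : ℤ => ‖thetaTerm q z n‖ := by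
  have h1 := summable_pow_choose_mul_pow (norm_nonneg q) hq ‖z‖
  have h2 := summable_pow_choose_mul_pow (norm_nonneg q) hq (‖q‖ * ‖z‖⁻¹)
  refine Summable.of_nat_of_neg (h1.congr fun n => ?_) (h2.congr fun n => ?_)
  · simp [thetaTerm, zpow_tri_natCast]
  · rw [thetaTerm, tri_neg, zpow_add₀ hq0, zpow_tri_natCast]
    simp [mul_pow]
    ring

theorem thetaTerm_add {q z : ℂ} (hq0 : q ≠ 0) (hz0 : z ≠ 0) (a b : ℤ) :
    thetaTerm q z (a + b) = thetaTerm q z a * thetaTerm q z b * (q ^ a) ^ b := by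
  simp only [thetaTerm, tri_add]
  rw [zpow_add₀ (by norm_num), zpow_add₀ hq0, zpow_add₀ hq0, zpow_add₀ hz0, zpow_mul]
  ring

/-- The shear `(n, k) ↦ (n + k, k)`. -/
def shearEquiv : ℤ × ℕ ≃ ℤ × ℕ where
  toFun x := (x.1 + x.2, x.2)
  invFun x := (x.1 - x.2, x.2)
  left_inv x := by simp
  right_inv x := by simp

/-- Since tri (M + k) = tri M + tri k + Mk, the powers of z cancel and the sum over k is Euler's
series at q^(M+1). -/
theorem hasSum_thetaTerm_mul_euler {q z : ℂ} (hq0 : q ≠ 0) (hq : ‖q‖ < 1) (hz0 : z ≠ 0) (M : ℤ) :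
    HasSum (fun k : ℕ => thetaTerm q z (M + k) * ((q / z) ^ k / qPoch q q k))
      (thetaTerm q z M * qPochInf (q ^ (M + 1)) q) := by
  refine ((hasSum_euler hq (q ^ (M + 1))).mul_left (thetaTerm q z M)).congr_fun fun k => ?_
  rw [thetaTerm_add hq0 hz0, mul_assoc, mul_assoc]
  congr 1
  rw [thetaTerm, zpow_tri_natCast, zpow_add₀ hq0, zpow_one]
  simp only [zpow_natCast, mul_pow, div_pow]
  field_simp

/-- This vanishing is what cuts sums over ℤ down to sums over ℕ, both in the triple product and in
the final double series. -/
theorem qPochInf_zpow_eq_zero {q : ℂ} (hq0 : q ≠ 0) {M : ℤ} (hM : M ≤ 0) :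
    qPochInf (q ^ M) q = 0 := by
  refine qPochInf_eq_zero (-M).toNat ?_
  rw [← zpow_natCast, Int.toNat_of_nonneg (by omega), ← zpow_add₀ hq0]
  simp

theorem HasSum.mul_of_summable_norm {ι κ : Type*} {f : ι → ℂ} {g : κ → ℂ} {a b : ℂ}
    (hf : HasSum f a) (hg : HasSum g b) (hf' : Summable fun i => ‖f i‖)
    (hg' : Summable fun k => ‖g k‖) : HasSum (fun x : ι × κ => f x.1 * g x.2) (a * b) :=
  hf.mul hg (summable_mul_of_summable_norm hf' hg')

/-- The Jacobi triple product identity. -/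
theorem hasSum_thetaTerm {q z : ℂ} (hq0 : q ≠ 0) (hq : ‖q‖ < 1) (hqz : ‖q‖ < ‖z‖) :
    HasSum (thetaTerm q z) (qPochInf q q * qPochInf z q * qPochInf (q / z) q) := by
  have hz0 : z ≠ 0 := norm_pos_iff.mp ((norm_nonneg q).trans_lt hqz)
  have hqz' : ‖q / z‖ < 1 := by
    rw [norm_div]; exact (div_lt_one (norm_pos_iff.mpr hz0)).mpr hqz
  have hs := summable_norm_thetaTerm hq0 hq z
  have he := summable_norm_euler_inv hq hqz'
  -- Multiply theta by Euler's series for 1/(q/z;q)_∞, which converges because |q| < |z|. After the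
  -- shear, summing over k first leaves (q;q)_∞ times Euler's series for (z;q)_∞.
  have hprod : HasSum (fun x : ℤ × ℕ => thetaTerm q z x.1 * ((q / z) ^ x.2 / qPoch q q x.2))
      ((∑' n, thetaTerm q z n) * (qPochInf (q / z) q)⁻¹) :=
    HasSum.mul_of_summable_norm (f := thetaTerm q z)
      (g := fun k : ℕ => (q / z) ^ k / qPoch q q k) hs.of_norm.hasSum (hasSum_euler_inv hq hqz') hs he
  have h0 : HasSum (fun x : ℤ × ℕ =>
      thetaTerm q z (x.1 + x.2) * ((q / z) ^ x.2 / qPoch q q x.2))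
      ((∑' n, thetaTerm q z n) * (qPochInf (q / z) q)⁻¹) :=
    (shearEquiv.hasSum_iff).mpr hprod
  have h1 : HasSum (fun M => thetaTerm q z M * qPochInf (q ^ (M + 1)) q)
      ((∑' n, thetaTerm q z n) * (qPochInf (q / z) q)⁻¹) :=
    h0.prod_fiberwise (hasSum_thetaTerm_mul_euler hq0 hq hz0)
  have hneg : ∀ M : ℤ, M ∉ Set.range ((↑) : ℕ → ℤ) →
      thetaTerm q z M * qPochInf (q ^ (M + 1)) q = 0 := fun M hM => by
    have hM0 : M < 0 := by
      by_contra! h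
      exact hM ⟨M.toNat, Int.toNat_of_nonneg h⟩
    rw [qPochInf_zpow_eq_zero hq0 (by omega), mul_zero]
  have h2 : HasSum (fun m : ℕ => thetaTerm q z m * qPochInf (q ^ ((m : ℤ) + 1)) q)
      ((∑' n, thetaTerm q z n) * (qPochInf (q / z) q)⁻¹) :=
    (Nat.cast_injective (R := ℤ)).hasSum_iff hneg |>.mpr h1
  have h5 : HasSum (fun m : ℕ => thetaTerm q z m * qPochInf (q ^ ((m : ℤ) + 1)) q)
      (qPochInf q q * qPochInf z q) := by
    refine ((hasSum_euler hq z).mul_left (qPochInf q q)).congr_fun fun m => ?_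
    have h3 := qPoch_mul_qPochInf q hq m
    have h4 := qPoch_ne_zero_of_norm_lt hq hq m
    have h5 : (q : ℂ) ^ ((m : ℤ) + 1) = q * q ^ m := by
      rw [zpow_add₀ hq0, zpow_natCast, zpow_one, mul_comm]
    rw [h5, ← h3, thetaTerm, zpow_tri_natCast, zpow_natCast, zpow_natCast]
    field_simp
  have h3 := qPochInf_ne_zero_of_norm_lt hqz' hq
  have : ∑' n, thetaTerm q z n = qPochInf q q * qPochInf z q * qPochInf (q / z) q := by
    rw [← h2.unique h5, inv_mul_cancel_right₀ h3]
  rw [← this]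
  exact hs.of_norm.hasSum

/-! ### Summation of `wzTerm` by a WZ-type recurrence in b -/

/-- The general term of the series obtained by pairing consecutive terms of `∑ phiTerm`. -/
noncomputable def wzTerm (q b : ℂ) (n : ℕ) : ℂ :=
  q ^ (n ^ 2 + n) * (∏ i ∈ Finset.range n, (b - q ^ i)) * qPoch (q * b ^ 2) q (n + 1) *
    (1 + b * q ^ (2 * n + 1)) / (qPoch (q ^ 3) (q ^ 3) n * qPoch (q ^ 2 * b ^ 3) (q ^ 3) (n + 1))

/-- The certificate for the first order recurrence `b ↦ b q` of `∑ wzTerm q b n`. -/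
noncomputable def wzCert (q b : ℂ) (n : ℕ) : ℂ :=
  -(b * q ^ ((n + 1) ^ 2 + (n + 1)) * (∏ i ∈ Finset.range n, (b - q ^ i)) *
    qPoch (q * b ^ 2) q (n + 2) /
    (qPoch (q ^ 3) (q ^ 3) n * qPoch (q ^ 2 * b ^ 3) (q ^ 3) (n + 2)))

/-- The ratio `F b / F (b q)` for `F b = ∑ wzTerm q b n`. -/
noncomputable def wzRatio (q b : ℂ) : ℂ :=
  (1 - q * b ^ 2) * (1 - q ^ 2 * b ^ 2) / ((1 - q * b) * (1 - q ^ 2 * b ^ 3))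

theorem prod_mul_sub_pow_succ (q b : ℂ) (n : ℕ) :
    ∏ i ∈ Finset.range (n + 1), (b * q - q ^ i)
      = (b * q - 1) * q ^ n * ∏ i ∈ Finset.range n, (b - q ^ i) := by
  rw [Finset.prod_range_succ', pow_zero, mul_comm, mul_assoc]
  congr 1
  rw [← Finset.card_range n, ← Finset.prod_const, Finset.card_range, ← Finset.prod_mul_distrib]
  exact Finset.prod_congr rfl fun i _ => by ring

/-- The ratio supplies exactly the factors missing from the shifted Pochhammer symbols, so the
result has the symbols of `wzCert` and the telescoping identity becomes polynomial. -/
theorem wzRatio_mul_wzTerm {q b : ℂ} (hq : ‖q‖ < 1) (hqb : 1 - q * b ≠ 0)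
    (hb3 : ‖q ^ 2 * b ^ 3‖ < 1) (n : ℕ) :
    wzRatio q b * wzTerm q (b * q) n
      = q ^ (n ^ 2 + n) * (∏ i ∈ Finset.range n, (b * q - q ^ i)) * qPoch (q * b ^ 2) q (n + 3) *
        (1 + b * q ^ (2 * n + 2)) /
        ((1 - q * b) * (qPoch (q ^ 3) (q ^ 3) n * qPoch (q ^ 2 * b ^ 3) (q ^ 3) (n + 2))) := by
  have h3 : ‖q ^ 3‖ < 1 := norm_pow_lt_one hq (by norm_num)
  have hD := qPoch_ne_zero_of_norm_lt hb3 h3 (n + 2)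
  have hT := qPoch_ne_zero_of_norm_lt h3 h3 n
  have e1 : qPoch (q * b ^ 2) q (n + 3)
      = (1 - q * b ^ 2) * (1 - q ^ 2 * b ^ 2) * qPoch (q * (b * q) ^ 2) q (n + 1) := by
    rw [qPoch_succ', qPoch_succ']
    ring_nf
  have e2 : qPoch (q ^ 2 * b ^ 3) (q ^ 3) (n + 2)
      = (1 - q ^ 2 * b ^ 3) * qPoch (q ^ 2 * (b * q) ^ 3) (q ^ 3) (n + 1) := by
    rw [qPoch_succ']
    ring_nf
  rw [e2] at hD ⊢
  have e3 : 1 + b * q * q ^ (2 * n + 1) = 1 + b * q ^ (2 * n + 2) := by ring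
  rw [e1, wzRatio, wzTerm, e3]
  have hD1 := left_ne_zero_of_mul hD
  have hD2 := right_ne_zero_of_mul hD
  field_simp

/-- Start of the telescoping: the certificate at index -1 counts as 0. -/
theorem wzTerm_sub_zero {q b : ℂ} (hq : ‖q‖ < 1) (hqb : 1 - q * b ≠ 0)
    (hb3 : ‖q ^ 2 * b ^ 3‖ < 1) :
    wzTerm q b 0 - wzRatio q b * wzTerm q (b * q) 0 = wzCert q b 0 := by
  have h3 : ‖q ^ 3‖ < 1 := norm_pow_lt_one hq (by norm_num)
  have h0 := one_sub_mul_pow_ne_zero hb3 h3 0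
  have h1 := one_sub_mul_pow_ne_zero hb3 h3 1
  rw [wzRatio_mul_wzTerm hq hqb hb3]
  simp only [wzTerm, wzCert, qPoch, Finset.prod_range_succ, Finset.prod_range_zero]
  simp only [pow_zero, pow_one, mul_one, one_mul] at *
  obtain ⟨u, hu⟩ : ∃ u, u = 1 - q ^ 2 * b ^ 3 * q ^ 3 := ⟨_, rfl⟩
  rw [← hu] at h1 ⊢
  field_simp
  rw [hu]
  ring

theorem wzTerm_sub_succ {q b : ℂ} (hq : ‖q‖ < 1) (hqb : 1 - q * b ≠ 0)
    (hb3 : ‖q ^ 2 * b ^ 3‖ < 1) (n : ℕ) :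
    wzTerm q b (n + 1) - wzRatio q b * wzTerm q (b * q) (n + 1)
      = wzCert q b (n + 1) - wzCert q b n := by
  have h3 : ‖q ^ 3‖ < 1 := norm_pow_lt_one hq (by norm_num)
  rw [wzRatio_mul_wzTerm hq hqb hb3, prod_mul_sub_pow_succ]
  simp only [wzTerm, wzCert, Finset.prod_range_succ]
  have hT := qPoch_ne_zero_of_norm_lt h3 h3 n
  have hT1 := one_sub_mul_pow_ne_zero h3 h3 n
  have hD := qPoch_ne_zero_of_norm_lt hb3 h3 (n + 2)
  have hD1 := one_sub_mul_pow_ne_zero hb3 h3 (n + 2)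
  rw [show n + 1 + 3 = (n + 2) + 1 + 1 by ring, show n + 1 + 2 = (n + 2) + 1 by ring,
    show n + 1 + 1 = n + 2 by ring, qPoch_succ (q ^ 3), qPoch_succ _ _ (n + 2 + 1),
    qPoch_succ _ _ (n + 2), qPoch_succ _ _ (n + 2)]
  -- Once the common factors are atoms and every power is written through Q = q^n, what is left is a
  -- rational identity in q, b and Q.
  generalize qPoch (q ^ 3) (q ^ 3) n = T at *
  generalize qPoch (q ^ 2 * b ^ 3) (q ^ 3) (n + 2) = D at *
  generalize qPoch (q * b ^ 2) q (n + 2) = A at *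
  generalize (∏ i ∈ Finset.range n, (b - q ^ i)) = P at *
  have p1 : q ^ ((n + 1) ^ 2 + (n + 1)) = q ^ (n ^ 2 + n) * (q ^ n) ^ 2 * q ^ 2 := by ring
  have p2 : q ^ ((n + 2) ^ 2 + (n + 2)) = q ^ (n ^ 2 + n) * (q ^ n) ^ 4 * q ^ 6 := by ring
  have p3 : (q ^ 3) ^ n = (q ^ n) ^ 3 := by ring
  have p4 : (q ^ 3) ^ (n + 2) = (q ^ n) ^ 3 * q ^ 6 := by ring
  have p5 : q ^ (2 * (n + 1) + 1) = (q ^ n) ^ 2 * q ^ 3 := by ring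
  have p6 : q ^ (2 * (n + 1) + 2) = (q ^ n) ^ 2 * q ^ 4 := by ring
  have p7 : q ^ (n + 2) = q ^ n * q ^ 2 := by ring
  have p8 : q ^ (n + 2 + 1) = q ^ n * q ^ 3 := by ring
  rw [p1, p2, p5, p6, p7, p8]
  rw [p3] at hT1 ⊢
  rw [p4] at hD1 ⊢
  generalize q ^ (n ^ 2 + n) = E at *
  generalize q ^ n = Q at *
  have hb : b * q - 1 = -(1 - q * b) := by ring
  rw [hb]
  -- The denominators stay opaque until they are cleared, and are expanded only for the last
  -- polynomial check.
  obtain ⟨u, hu⟩ : ∃ u, u = 1 - q ^ 2 * b ^ 3 * (Q ^ 3 * q ^ 6) := ⟨_, rfl⟩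
  obtain ⟨v, hv⟩ : ∃ v, v = 1 - q ^ 3 * Q ^ 3 := ⟨_, rfl⟩
  rw [← hu] at hD1 ⊢
  rw [← hv] at hT1 ⊢
  field_simp
  rw [hu, hv]
  ring

theorem norm_prod_sub_pow_le {q b : ℂ} {β : ℝ} (hq : ‖q‖ < 1) (hb : ‖b‖ ≤ β) (n : ℕ) :
    ‖∏ i ∈ Finset.range n, (b - q ^ i)‖ ≤ (β + 1) ^ n := by
  rw [norm_prod, ← Finset.card_range n, ← Finset.prod_const, Finset.card_range]
  refine Finset.prod_le_prod (fun _ _ => norm_nonneg _) fun i _ => ?_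
  refine (norm_sub_le _ _).trans (add_le_add hb ?_)
  rw [norm_pow]
  exact pow_le_one₀ (norm_nonneg _) hq.le

theorem norm_qPoch_mul_sq_le {q b : ℂ} {β : ℝ} (hq : ‖q‖ < 1) (hb : ‖b‖ ≤ β) (n : ℕ) :
    ‖qPoch (q * b ^ 2) q n‖ ≤ (1 + β ^ 2) ^ n := by
  refine (norm_qPoch_le hq.le n).trans ?_
  gcongr
  rw [norm_mul, norm_pow]
  exact (mul_le_of_le_one_left (by positivity) hq.le).trans (by gcongr)

theorem norm_inv_qPoch_le_of_le {A q : ℂ} {τ : ℝ} (hA : ‖A‖ ≤ τ) (hτ : τ < 1) (hq : ‖q‖ < 1)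
    (n : ℕ) : ‖(qPoch A q n)⁻¹‖ ≤ ((1 - τ)⁻¹) ^ n := by
  refine (norm_inv_qPoch_le (hA.trans_lt hτ) hq n).trans ?_
  have : 0 < 1 - τ := sub_pos.mpr hτ
  have : 0 ≤ (1 - ‖A‖)⁻¹ := inv_nonneg.mpr (by linarith)
  gcongr

theorem norm_pow_le_pow_choose {q : ℂ} (hq : ‖q‖ < 1) {m n : ℕ} (h : n.choose 2 ≤ m) :
    ‖q ^ m‖ ≤ ‖q‖ ^ n.choose 2 := by
  rw [norm_pow]
  exact pow_le_pow_of_le_one (norm_nonneg _) hq.le h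

theorem choose_two_le_sq (n : ℕ) : n.choose 2 ≤ n ^ 2 := Nat.choose_le_pow n 2

/-- The bound sees b only through β and τ, so it holds uniformly along b, bq, bq², … and serves as
the dominating series in the limit b → 0. -/
theorem norm_wzTerm_le {q b : ℂ} {β τ : ℝ} (hq : ‖q‖ < 1) (hb : ‖b‖ ≤ β)
    (hb3 : ‖q ^ 2 * b ^ 3‖ ≤ τ) (hτ : τ < 1) (n : ℕ) :
    ‖wzTerm q b n‖ ≤ ‖q‖ ^ n.choose 2 *
      ((β + 1) * (1 + β ^ 2) * (1 - ‖q ^ 3‖)⁻¹ * (1 - τ)⁻¹) ^ n *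
        ((1 + β ^ 2) * (1 + β) * (1 - τ)⁻¹) := by
  have h3 : ‖q ^ 3‖ < 1 := norm_pow_lt_one hq (by norm_num)
  have hβ : 0 ≤ β := (norm_nonneg b).trans hb
  have h1 := norm_pow_le_pow_choose hq (m := n ^ 2 + n) (n := n)
    ((choose_two_le_sq n).trans (Nat.le_add_right _ _))
  have h2 := norm_prod_sub_pow_le hq hb n
  have h4 := norm_qPoch_mul_sq_le hq hb (n + 1)
  have h5 : ‖1 + b * q ^ (2 * n + 1)‖ ≤ 1 + β := by
    refine (norm_add_le _ _).trans ?_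
    rw [norm_one, norm_mul, norm_pow]
    gcongr
    exact (mul_le_of_le_one_right (norm_nonneg _) (pow_le_one₀ (norm_nonneg _) hq.le)).trans hb
  have h6 := norm_inv_qPoch_le h3 h3 n
  have h7 := norm_inv_qPoch_le_of_le hb3 hτ h3 (n + 1)
  have hτ' : 0 < 1 - τ := sub_pos.mpr hτ
  have hq3' : 0 < 1 - ‖q ^ 3‖ := sub_pos.mpr h3
  rw [wzTerm, div_eq_mul_inv, mul_inv, norm_mul, norm_mul, norm_mul, norm_mul, norm_mul]
  calc _ ≤ ‖q‖ ^ n.choose 2 * (β + 1) ^ n * (1 + β ^ 2) ^ (n + 1) * (1 + β) *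
        (((1 - ‖q ^ 3‖)⁻¹) ^ n * ((1 - τ)⁻¹) ^ (n + 1)) := by gcongr
    _ = _ := by simp only [mul_pow]; ring

theorem norm_wzCert_le {q b : ℂ} {β τ : ℝ} (hq : ‖q‖ < 1) (hb : ‖b‖ ≤ β)
    (hb3 : ‖q ^ 2 * b ^ 3‖ ≤ τ) (hτ : τ < 1) (n : ℕ) :
    ‖wzCert q b n‖ ≤ ‖q‖ ^ n.choose 2 *
      ((β + 1) * (1 + β ^ 2) * (1 - ‖q ^ 3‖)⁻¹ * (1 - τ)⁻¹) ^ n *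
        (β * (1 + β ^ 2) ^ 2 * ((1 - τ)⁻¹) ^ 2) := by
  have h3 : ‖q ^ 3‖ < 1 := norm_pow_lt_one hq (by norm_num)
  have hβ : 0 ≤ β := (norm_nonneg b).trans hb
  have h1 := norm_pow_le_pow_choose hq (m := (n + 1) ^ 2 + (n + 1)) (n := n)
    ((choose_two_le_sq n).trans (by nlinarith))
  have h2 := norm_prod_sub_pow_le hq hb n
  have h4 := norm_qPoch_mul_sq_le hq hb (n + 2)
  have h6 := norm_inv_qPoch_le h3 h3 n
  have h7 := norm_inv_qPoch_le_of_le hb3 hτ h3 (n + 2)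
  have hτ' : 0 < 1 - τ := sub_pos.mpr hτ
  have hq3' : 0 < 1 - ‖q ^ 3‖ := sub_pos.mpr h3
  rw [wzCert, norm_neg, div_eq_mul_inv, mul_inv, norm_mul, norm_mul, norm_mul, norm_mul, norm_mul]
  calc _ ≤ β * ‖q‖ ^ n.choose 2 * (β + 1) ^ n * (1 + β ^ 2) ^ (n + 2) *
        (((1 - ‖q ^ 3‖)⁻¹) ^ n * ((1 - τ)⁻¹) ^ (n + 2)) := by gcongr
    _ = _ := by simp only [mul_pow]; ring

theorem summable_norm_wzTerm {q b : ℂ} (hq : ‖q‖ < 1) (hb3 : ‖q ^ 2 * b ^ 3‖ < 1) :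
    Summable fun n => ‖wzTerm q b n‖ :=
  Summable.of_nonneg_of_le (fun _ => norm_nonneg _) (norm_wzTerm_le hq le_rfl le_rfl hb3)
    ((summable_pow_choose_mul_pow (norm_nonneg q) hq _).mul_right _)

theorem tendsto_wzCert {q b : ℂ} (hq : ‖q‖ < 1) (hb3 : ‖q ^ 2 * b ^ 3‖ < 1) :
    Tendsto (wzCert q b) atTop (𝓝 0) :=
  squeeze_zero_norm (norm_wzCert_le hq le_rfl le_rfl hb3)
    ((summable_pow_choose_mul_pow (norm_nonneg q) hq _).mul_right _).tendsto_atTop_zero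

theorem norm_mul_pow_le {q : ℂ} (hq : ‖q‖ < 1) (b : ℂ) (k : ℕ) : ‖b * q ^ k‖ ≤ ‖b‖ := by
  rw [norm_mul, norm_pow]
  exact mul_le_of_le_one_right (norm_nonneg _) (pow_le_one₀ (norm_nonneg _) hq.le)

theorem norm_sq_mul_cube_le {q : ℂ} (hq : ‖q‖ < 1) (b : ℂ) (k : ℕ) :
    ‖q ^ 2 * (b * q ^ k) ^ 3‖ ≤ ‖q ^ 2 * b ^ 3‖ := by
  rw [norm_mul, norm_mul, norm_pow, norm_pow (b * q ^ k), norm_pow b]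
  gcongr
  exact norm_mul_pow_le hq b k

theorem tsum_wzTerm_eq {q b : ℂ} (hq : ‖q‖ < 1) (hqb : 1 - q * b ≠ 0)
    (hb3 : ‖q ^ 2 * b ^ 3‖ < 1) :
    ∑' n, wzTerm q b n = wzRatio q b * ∑' n, wzTerm q (b * q) n := by
  have hb3' : ‖q ^ 2 * (b * q) ^ 3‖ < 1 := by
    simpa using (norm_sq_mul_cube_le hq b 1).trans_lt hb3
  have s1 := (summable_norm_wzTerm hq hb3).of_norm
  have s2 := ((summable_norm_wzTerm hq hb3').of_norm).mul_left (wzRatio q b)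
  have hpart : ∀ n, ∑ i ∈ Finset.range (n + 1), (wzTerm q b i - wzRatio q b * wzTerm q (b * q) i)
      = wzCert q b n := by
    intro n
    induction n with
    | zero => simpa using wzTerm_sub_zero hq hqb hb3
    | succ n ih => rw [Finset.sum_range_succ, ih, wzTerm_sub_succ hq hqb hb3]; ring
  have h := ((s1.sub s2).hasSum.tendsto_sum_nat.comp (tendsto_add_atTop_nat 1))
  have h0 := tendsto_nhds_unique (h.congr hpart) (tendsto_wzCert hq hb3)
  rwa [s1.tsum_sub s2, tsum_mul_left, sub_eq_zero] at h0

/-- Each step b ↦ bq contributes two consecutive factors of (q b²;q), hence the length 2n.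
Denominators are cleared so that both sides have limits directly. -/
theorem tsum_wzTerm_eq_iterate {q b : ℂ} (hq : ‖q‖ < 1) (hqb : ‖q * b‖ < 1)
    (hb3 : ‖q ^ 2 * b ^ 3‖ < 1) (n : ℕ) :
    qPoch (q * b) q n * qPoch (q ^ 2 * b ^ 3) (q ^ 3) n * ∑' i, wzTerm q b i
      = qPoch (q * b ^ 2) q (2 * n) * ∑' i, wzTerm q (b * q ^ n) i := by
  have h3 : ‖q ^ 3‖ < 1 := norm_pow_lt_one hq (by norm_num)
  induction n with
  | zero => simp [qPoch]
  | succ n ih =>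
    have h1 : 1 - q * (b * q ^ n) ≠ 0 := by
      have := one_sub_mul_pow_ne_zero hqb hq n
      rwa [← mul_assoc]
    have h2 : 1 - q ^ 2 * (b * q ^ n) ^ 3 ≠ 0 := by
      have := one_sub_mul_pow_ne_zero hb3 h3 n
      rw [← pow_mul, mul_comm 3 n, pow_mul] at this
      rwa [mul_pow, ← mul_assoc]
    rw [tsum_wzTerm_eq hq h1 ((norm_sq_mul_cube_le hq b n).trans_lt hb3), wzRatio] at ih
    rw [show 2 * (n + 1) = 2 * n + 1 + 1 by ring, qPoch_succ, qPoch_succ, qPoch_succ, qPoch_succ,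
      pow_succ q n, ← mul_assoc b]
    have e1 : 1 - q * b * q ^ n = 1 - q * (b * q ^ n) := by ring
    have e2 : 1 - q ^ 2 * b ^ 3 * (q ^ 3) ^ n = 1 - q ^ 2 * (b * q ^ n) ^ 3 := by ring
    have e3 : 1 - q * b ^ 2 * q ^ (2 * n) = 1 - q * (b * q ^ n) ^ 2 := by ring
    have e4 : 1 - q * b ^ 2 * q ^ (2 * n + 1) = 1 - q ^ 2 * (b * q ^ n) ^ 2 := by ring
    rw [e1, e2, e3, e4]
    calc _ = (qPoch (q * b) q n * qPoch (q ^ 2 * b ^ 3) (q ^ 3) n * ∑' i, wzTerm q b i) *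
          ((1 - q * (b * q ^ n)) * (1 - q ^ 2 * (b * q ^ n) ^ 3)) := by ring
      _ = _ := by
        rw [ih, div_mul_eq_mul_div, mul_div_assoc', div_mul_cancel₀ _ (mul_ne_zero h1 h2)]
        ring

theorem continuous_qPoch (q : ℂ) (n : ℕ) : Continuous fun A => qPoch A q n := by
  unfold qPoch
  fun_prop

theorem tendsto_wzTerm_zero {q b : ℂ} (hq : ‖q‖ < 1) (n : ℕ) :
    Tendsto (fun k : ℕ => wzTerm q (b * q ^ k) n) atTop (𝓝 (wzTerm q 0 n)) := by
  have h3 : ‖q ^ 3‖ < 1 := norm_pow_lt_one hq (by norm_num)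
  have hb : Tendsto (fun k : ℕ => b * q ^ k) atTop (𝓝 0) := by
    simpa using (tendsto_pow_atTop_nhds_zero_of_norm_lt_one hq).const_mul b
  have hc : ContinuousAt (fun c => wzTerm q c n) 0 := by
    have := continuous_qPoch q (n + 1)
    have := continuous_qPoch (q ^ 3) (n + 1)
    unfold wzTerm
    refine ContinuousAt.div (Continuous.continuousAt (by fun_prop))
      (Continuous.continuousAt (by fun_prop)) (mul_ne_zero ?_ ?_)
    · exact qPoch_ne_zero_of_norm_lt h3 h3 n
    · simp [qPoch]
  exact hc.tendsto.comp hb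

theorem sq_add_self_eq_choose (n : ℕ) : n ^ 2 + n = 2 * n.choose 2 + 2 * n := by
  induction n with
  | zero => simp
  | succ n ih =>
    rw [Nat.choose_succ_succ', Nat.choose_one_right]
    linarith

/-- At b = 0 the product of the b - q^i supplies the sign and a further q^(n choose 2), which makes
this Euler's series for (q²;q³)_∞. -/
theorem wzTerm_zero (q : ℂ) (n : ℕ) :
    wzTerm q 0 n = (-1) ^ n * (q ^ 3) ^ n.choose 2 * (q ^ 2) ^ n / qPoch (q ^ 3) (q ^ 3) n := by
  have h1 : ∏ i ∈ Finset.range n, (0 - q ^ i) = (-1) ^ n * q ^ n.choose 2 := by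
    induction n with
    | zero => simp
    | succ n ih =>
      rw [Finset.prod_range_succ, ih, Nat.choose_succ_succ', Nat.choose_one_right]
      ring
  rw [wzTerm, h1, sq_add_self_eq_choose]
  simp [qPoch]
  ring

theorem tsum_wzTerm {q b : ℂ} (hq : ‖q‖ < 1) (hqb : ‖q * b‖ < 1) (hb3 : ‖q ^ 2 * b ^ 3‖ < 1) :
    qPochInf (q * b) q * qPochInf (q ^ 2 * b ^ 3) (q ^ 3) * ∑' i, wzTerm q b i
      = qPochInf (q * b ^ 2) q * qPochInf (q ^ 2) (q ^ 3) := by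
  have h3 : ‖q ^ 3‖ < 1 := norm_pow_lt_one hq (by norm_num)
  have hlim : Tendsto (fun k : ℕ => ∑' n, wzTerm q (b * q ^ k) n) atTop
      (𝓝 (∑' n, wzTerm q 0 n)) :=
    tendsto_tsum_of_dominated_convergence
      ((summable_pow_choose_mul_pow (norm_nonneg q) hq _).mul_right _)
      (fun n => tendsto_wzTerm_zero hq n)
      (.of_forall fun k n => norm_wzTerm_le hq (norm_mul_pow_le hq b k)
        (norm_sq_mul_cube_le hq b k) hb3 n)
  have h0 : ∑' n, wzTerm q 0 n = qPochInf (q ^ 2) (q ^ 3) := by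
    simp only [wzTerm_zero]
    exact (hasSum_euler h3 _).tsum_eq
  rw [h0] at hlim
  have hl := ((tendsto_qPoch (q * b) hq).mul (tendsto_qPoch (q ^ 2 * b ^ 3) h3)).mul_const
    (∑' i, wzTerm q b i)
  have htwo : Tendsto (fun n : ℕ => 2 * n) atTop atTop :=
    tendsto_id.const_mul_atTop' (by norm_num)
  have hr := ((tendsto_qPoch (q * b ^ 2) hq).comp htwo).mul hlim
  exact tendsto_nhds_unique hl (hr.congr fun n => (tsum_wzTerm_eq_iterate hq hqb hb3 n).symm)

/-! ### Product evaluation of `∑ phiTerm` -/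

/-- The general term of `∑ (-1)^k p^(3C(k,2)+4k) (p;p³)_k / (p⁹;p⁹)_k`. -/
noncomputable def phiTerm (p : ℂ) (k : ℕ) : ℂ :=
  (-1) ^ k * p ^ (3 * k.choose 2 + 4 * k) * qPoch p (p ^ 3) k / qPoch (p ^ 9) (p ^ 9) k

theorem summable_norm_phiTerm {p : ℂ} (hp : ‖p‖ < 1) : Summable fun k => ‖phiTerm p k‖ := by
  have h3 : ‖p ^ 3‖ < 1 := norm_pow_lt_one hp (by norm_num)
  have h9 : ‖p ^ 9‖ < 1 := norm_pow_lt_one hp (by norm_num)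
  refine Summable.of_nonneg_of_le (fun _ => norm_nonneg _) (fun k => ?_)
    (summable_pow_choose_mul_pow (norm_nonneg p) hp ((1 + ‖p‖) * (1 - ‖p ^ 9‖)⁻¹))
  have h1 := norm_pow_le_pow_choose hp (m := 3 * k.choose 2 + 4 * k) (n := k) (by omega)
  have h2 := norm_qPoch_le (A := p) h3.le k
  have h4 := norm_inv_qPoch_le h9 h9 k
  rw [phiTerm, div_eq_mul_inv, norm_mul, norm_mul, norm_mul, mul_pow, ← mul_assoc]
  calc _ ≤ 1 * ‖p‖ ^ k.choose 2 * (1 + ‖p‖) ^ k * ((1 - ‖p ^ 9‖)⁻¹) ^ k := by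
        gcongr
        simp
    _ = _ := by ring

theorem choose_two_two_mul (n : ℕ) : (2 * n).choose 2 + n = 2 * n ^ 2 := by
  have := sq_add_self_eq_choose (2 * n)
  linarith

/-- Each p⁻¹ - p^(6i) is p⁻¹ (1 - p^(6i+1)), so the product in `wzTerm` gives (p;p⁶)_n. Splitting
(p;p³)_{2n} and (p⁹;p⁹)_{2n} by parity supplies the other symbols. -/
theorem phiTerm_add {p : ℂ} (hp0 : p ≠ 0) (hp : ‖p‖ < 1) (n : ℕ) :
    phiTerm p (2 * n) + phiTerm p (2 * n + 1) = wzTerm (p ^ 6) p⁻¹ n := by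
  have h9 : ‖p ^ 9‖ < 1 := norm_pow_lt_one hp (by norm_num)
  have h18 : ‖p ^ 18‖ < 1 := norm_pow_lt_one hp (by norm_num)
  have e1 : ∏ i ∈ Finset.range n, (p⁻¹ - (p ^ 6) ^ i) = (p ^ n)⁻¹ * qPoch p (p ^ 6) n := by
    rw [qPoch, ← inv_pow]
    nth_rw 2 [← Finset.card_range n]
    rw [← Finset.prod_const, ← Finset.prod_mul_distrib]
    refine Finset.prod_congr rfl fun i _ => ?_
    field_simp
  have e2 : p ^ 6 * p⁻¹ ^ 2 = p ^ 4 := by field_simp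
  have e3 : (p ^ 6) ^ 2 * p⁻¹ ^ 3 = p ^ 9 := by field_simp
  have e4 : p⁻¹ * (p ^ 6) ^ (2 * n + 1) = p ^ 5 * (p ^ n) ^ 12 := by
    field_simp
    ring
  have e5 : (p ^ 6) ^ (n ^ 2 + n) = p ^ (6 * n ^ 2 + 5 * n) * p ^ n := by ring
  have e6 : 3 * (2 * n).choose 2 + 4 * (2 * n) = 6 * n ^ 2 + 5 * n := by
    have := choose_two_two_mul n
    linarith
  have e7 : 3 * (2 * n + 1).choose 2 + 4 * (2 * n + 1) = 6 * n ^ 2 + 5 * n + 6 * n + 4 := by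
    rw [Nat.choose_succ_succ', Nat.choose_one_right]
    linarith
  have e8 : (-1 : ℂ) ^ (2 * n) = 1 := by simp [pow_mul]
  have q1 := qPoch_two_mul p (p ^ 3) n
  have q2 := qPoch_two_mul (p ^ 9) (p ^ 9) n
  rw [← pow_mul, ← pow_succ'] at q1
  rw [← pow_mul, ← pow_add] at q2
  norm_num at q1 q2
  have hD := qPoch_ne_zero_of_norm_lt h9 h18 n
  have hD1 := one_sub_mul_pow_ne_zero h9 h18 n
  have hT := qPoch_ne_zero_of_norm_lt h18 h18 n
  rw [wzTerm, e1, e2, e3, e4, e5, phiTerm, phiTerm, e6, e7, pow_succ (-1 : ℂ), e8,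
    qPoch_succ, qPoch_succ, qPoch_succ, qPoch_succ, q1, q2, show (p ^ 6) ^ 3 = p ^ 18 by ring,
    show (p ^ 3) ^ (2 * n) = (p ^ n) ^ 6 by ring, show (p ^ 9) ^ (2 * n) = (p ^ n) ^ 18 by ring,
    show (p ^ 6) ^ n = (p ^ n) ^ 6 by ring, show (p ^ 18) ^ n = (p ^ n) ^ 18 by ring,
    show p ^ (6 * n ^ 2 + 5 * n + 6 * n + 4) = p ^ (6 * n ^ 2 + 5 * n) * (p ^ n) ^ 6 * p ^ 4 by ring]
  rw [show (p ^ 18) ^ n = (p ^ n) ^ 18 by ring] at hD1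
  have hpn : p ^ n ≠ 0 := pow_ne_zero _ hp0
  generalize p ^ n = P at *
  obtain ⟨u, hu⟩ : ∃ u, u = 1 - p ^ 9 * P ^ 18 := ⟨_, rfl⟩
  rw [← hu] at hD1 ⊢
  field_simp
  rw [hu]
  ring

theorem tsum_phiTerm {p : ℂ} (hp0 : p ≠ 0) (hp : ‖p‖ < 1) :
    qPochInf (p ^ 5) (p ^ 6) * qPochInf (p ^ 9) (p ^ 18) * ∑' k, phiTerm p k
      = qPochInf (p ^ 4) (p ^ 6) * qPochInf (p ^ 12) (p ^ 18) := by
  have e1 : p ^ 6 * p⁻¹ = p ^ 5 := by field_simp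
  have e2 : p ^ 6 * p⁻¹ ^ 2 = p ^ 4 := by field_simp
  have e3 : (p ^ 6) ^ 2 * p⁻¹ ^ 3 = p ^ 9 := by field_simp
  have hs := (summable_norm_phiTerm hp).of_norm
  have h1 : Summable fun n => phiTerm p (2 * n) :=
    hs.comp_injective fun a b h => by simpa using h
  have h2 : Summable fun n => phiTerm p (2 * n + 1) :=
    hs.comp_injective fun a b h => by simpa using h
  have h3 := tsum_wzTerm (q := p ^ 6) (b := p⁻¹) (norm_pow_lt_one hp (by norm_num))
    (by rw [e1]; exact norm_pow_lt_one hp (by norm_num))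
    (by rw [e3]; exact norm_pow_lt_one hp (by norm_num))
  rw [e1, e2, e3, ← pow_mul, ← pow_mul] at h3
  norm_num at h3
  rw [← h3, ← tsum_even_add_odd h1 h2, ← h1.tsum_add h2]
  simp only [phiTerm_add hp0 hp]

/-! ### The theta factor -/

theorem thetaTerm_mul_self_left {q z : ℂ} (hq0 : q ≠ 0) (hz0 : z ≠ 0) (n : ℤ) :
    thetaTerm q (q * z) n = -z⁻¹ * thetaTerm q z (n + 1) := by
  have : thetaTerm q z 1 = -z := by simp [thetaTerm, show tri 1 = 0 from rfl]
  rw [add_comm, thetaTerm_add hq0 hz0, this, thetaTerm, thetaTerm, mul_zpow, zpow_one]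
  field_simp

theorem hasSum_thetaTerm_mul_self_left {q z : ℂ} (hq0 : q ≠ 0) (hq : ‖q‖ < 1) (hqz : ‖q‖ < ‖z‖) :
    HasSum (thetaTerm q (q * z))
      (-z⁻¹ * (qPochInf q q * qPochInf z q * qPochInf (q / z) q)) := by
  have hz0 : z ≠ 0 := norm_pos_iff.mp ((norm_nonneg q).trans_lt hqz)
  exact (((Equiv.addRight (1 : ℤ)).hasSum_iff.mpr (hasSum_thetaTerm hq0 hq hqz)).mul_left
    (-z⁻¹)).congr_fun (thetaTerm_mul_self_left hq0 hz0)

/-- The point p⁴ lies outside the range |p³| < |z|, so the triple product is taken at z = p and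
shifted by one quasi-period. Its three factors reassemble (p;p)_∞. -/
theorem hasSum_thetaTerm_cube_fourth {p : ℂ} (hp0 : p ≠ 0) (hp : ‖p‖ < 1) :
    HasSum (thetaTerm (p ^ 3) (p ^ 4)) (-p⁻¹ * qPochInf p p) := by
  have h3 : ‖p ^ 3‖ < 1 := norm_pow_lt_one hp (by norm_num)
  have h := hasSum_thetaTerm_mul_self_left (z := p) (pow_ne_zero 3 hp0) h3 (by
    rw [norm_pow]
    exact pow_lt_self_of_lt_one₀ (norm_pos_iff.mpr hp0) hp (by norm_num))
  have e1 : p ^ 3 / p = p ^ 2 := by field_simp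
  have e2 := qPochInf_cube p hp
  rw [e1, ← pow_succ] at h
  rw [show p * p = p ^ 2 by ring, show p * p ^ 2 = p ^ 3 by ring] at e2
  rw [← e2]
  convert h using 2
  ring

/-! ### The double series reducing to `∑ phiTerm` -/

/-- The exponent of `p` in `pairTerm`. -/
def pairExp (k m : ℕ) : ℤ := 6 * tri k + 3 * tri m - 3 * m * k + 5 * k + 2 * m

/-- The general term of a double series which reduces to `∑ phiTerm` when summed over `m`. -/
noncomputable def pairTerm (p : ℂ) (x : ℕ × ℕ) : ℂ :=
  (-1) ^ x.2 * p ^ pairExp x.1 x.2 / (qPoch (p ^ 9) (p ^ 9) x.1 * qPoch (p ^ 3) (p ^ 3) x.2)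

/-- The quadratic part of the exponent is positive definite, so it dominates linear growth of any
slope N despite the cross term -3mk. Completing squares in m - k and k leaves a nonnegative
remainder. -/
theorem le_pairExp (k m : ℕ) (N : ℤ) : N * (k + m) - N ^ 2 ≤ pairExp k m := by
  have h1 := two_mul_tri k
  have h2 := two_mul_tri m
  rw [pairExp]
  nlinarith [sq_nonneg (3 * ((m : ℤ) - k) - N), sq_nonneg (3 * (k : ℤ) - 2 * N), sq_nonneg N]

theorem exists_mul_pow_le_one {r : ℝ} (hr : r < 1) {C : ℝ} (hC : 0 < C) :
    ∃ L : ℕ, C * r ^ L ≤ 1 := by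
  obtain ⟨L, hL⟩ := exists_pow_lt_of_lt_one (inv_pos.mpr hC) hr
  refine ⟨L, ?_⟩
  have := mul_le_mul_of_nonneg_left hL.le hC.le
  rwa [mul_inv_cancel₀ hC.ne'] at this

theorem summable_norm_pairTerm {p : ℂ} (hp0 : p ≠ 0) (hp : ‖p‖ < 1) :
    Summable fun x => ‖pairTerm p x‖ := by
  have h3 : ‖p ^ 3‖ < 1 := norm_pow_lt_one hp (by norm_num)
  have h9 : ‖p ^ 9‖ < 1 := norm_pow_lt_one hp (by norm_num)
  have hr0 : 0 < ‖p‖ := norm_pos_iff.mpr hp0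
  set r := ‖p‖ with hr
  have hC : 0 < (1 - r)⁻¹ := inv_pos.mpr (sub_pos.mpr hp)
  have hbound : ∀ n : ℕ, n ≠ 0 → ∀ k : ℕ, ‖(qPoch (p ^ n) (p ^ n) k)⁻¹‖ ≤ ((1 - r)⁻¹) ^ k := by
    intro n hn k
    refine norm_inv_qPoch_le_of_le ?_ hp (norm_pow_lt_one hp hn) k
    rw [norm_pow]
    exact pow_le_of_le_one hr0.le hp.le hn
  -- Slope L absorbs the geometric growth of the inverse Pochhammer symbols; one further unit of
  -- slope leaves a summable geometric factor.
  obtain ⟨L, hL⟩ := exists_mul_pow_le_one hp hC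
  have hgeo : Summable fun x : ℕ × ℕ => r ^ x.1 * r ^ x.2 := by
    have := summable_geometric_of_lt_one hr0.le hp
    exact Summable.mul_of_nonneg this this (fun _ => by positivity) (fun _ => by positivity)
  refine Summable.of_nonneg_of_le (fun _ => norm_nonneg _) (fun ⟨k, m⟩ => ?_)
    (hgeo.mul_left (r ^ (-(L + 1 : ℤ) ^ 2)))
  have h1 := hbound 9 (by norm_num) k
  have h2 := hbound 3 (by norm_num) m
  have h4 : r ^ pairExp k m ≤ r ^ ((L + 1 : ℤ) * (k + m) - (L + 1 : ℤ) ^ 2) :=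
    zpow_le_zpow_right_of_le_one₀ hr0 hp.le (le_pairExp k m _)
  have h5 : r ^ ((L + 1 : ℤ) * (k + m) - (L + 1 : ℤ) ^ 2)
      = r ^ (-(L + 1 : ℤ) ^ 2) * (r ^ L) ^ (k + m) * (r ^ k * r ^ m) := by
    rw [← pow_add, ← pow_mul, ← zpow_natCast, ← zpow_natCast, ← zpow_add₀ hr0.ne',
      ← zpow_add₀ hr0.ne']
    congr 1
    push_cast
    ring
  rw [pairTerm, div_eq_mul_inv, mul_inv, norm_mul, norm_mul, norm_mul, norm_zpow, norm_pow,
    norm_neg, norm_one, one_pow, one_mul, ← hr]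
  calc _ ≤ (r ^ (-(L + 1 : ℤ) ^ 2) * (r ^ L) ^ (k + m) * (r ^ k * r ^ m)) *
        (((1 - r)⁻¹) ^ k * ((1 - r)⁻¹) ^ m) := by
        rw [← h5]
        gcongr
    _ = ((1 - r)⁻¹ * r ^ L) ^ (k + m) * (r ^ (-(L + 1 : ℤ) ^ 2) * (r ^ k * r ^ m)) := by ring
    _ ≤ 1 * (r ^ (-(L + 1 : ℤ) ^ 2) * (r ^ k * r ^ m)) := by
        gcongr
        exact pow_le_one₀ (by positivity) hL
    _ = _ := one_mul _

/-- Reflection: each factor 1 - p^(-a) is -p^(-a) (1 - p^a), and the a that occur are 1, 4, …, 3k -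
2. -/
theorem qPoch_zpow_sub {p : ℂ} (hp0 : p ≠ 0) (k : ℕ) :
    qPoch (p ^ (2 - 3 * k : ℤ)) (p ^ 3) k
      = (-1) ^ k * p ^ (2 * k - 3 * tri k - 3 * k : ℤ) * qPoch p (p ^ 3) k := by
  induction k with
  | zero => simp [qPoch, tri]
  | succ k ih =>
    have e1 : p ^ (2 - 3 * (k + 1 : ℕ) : ℤ) * p ^ 3 = p ^ (2 - 3 * k : ℤ) := by
      rw [← zpow_natCast p 3, ← zpow_add₀ hp0]
      congr 1
      push_cast
      ring
    have e2 : 1 - p ^ (2 - 3 * (k + 1 : ℕ) : ℤ)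
        = -p ^ (2 - 3 * (k + 1 : ℕ) : ℤ) * (1 - p * (p ^ 3) ^ k) := by
      rw [mul_sub, mul_one, ← pow_mul, ← pow_succ', neg_mul, ← zpow_natCast p (3 * k + 1),
        ← zpow_add₀ hp0]
      have : (2 - 3 * (k + 1 : ℕ) : ℤ) + (3 * k + 1 : ℕ) = 0 := by push_cast; ring
      rw [this, zpow_zero]
      ring
    have e3 : p ^ (2 * (k + 1 : ℕ) - 3 * tri (k + 1 : ℕ) - 3 * (k + 1 : ℕ) : ℤ)
        = p ^ (2 - 3 * (k + 1 : ℕ) : ℤ) * p ^ (2 * k - 3 * tri k - 3 * k : ℤ) := by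
      rw [← zpow_add₀ hp0]
      congr 1
      push_cast
      rw [tri_add, show tri 1 = 0 from rfl]
      ring
    rw [qPoch_succ', e1, ih, e2, qPoch_succ, e3]
    ring

theorem qPochInf_zpow_sub {p : ℂ} (hp0 : p ≠ 0) (hp : ‖p‖ < 1) (k : ℕ) :
    qPochInf (p ^ (2 - 3 * k : ℤ)) (p ^ 3)
      = (-1) ^ k * p ^ (2 * k - 3 * tri k - 3 * k : ℤ) * qPoch p (p ^ 3) k
        * qPochInf (p ^ 2) (p ^ 3) := by
  rw [← qPoch_zpow_sub hp0, ← qPoch_mul_qPochInf _ (norm_pow_lt_one hp (by norm_num)) k]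
  congr 2
  rw [← pow_mul, ← zpow_natCast p (3 * k), ← zpow_add₀ hp0, ← zpow_natCast]
  congr 1
  push_cast
  ring

/-- For fixed k the cross term shifts the argument of Euler's series to p^(2-3k); the reflected
initial factors produce the (p;p³)_k of `phiTerm`. -/
theorem hasSum_pairTerm_right {p : ℂ} (hp0 : p ≠ 0) (hp : ‖p‖ < 1) (k : ℕ) :
    HasSum (fun m => pairTerm p (k, m)) (qPochInf (p ^ 2) (p ^ 3) * phiTerm p k) := by
  have h3 : ‖p ^ 3‖ < 1 := norm_pow_lt_one hp (by norm_num)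
  have h := (hasSum_euler h3 (p ^ (2 - 3 * k : ℤ))).mul_left
    (p ^ (6 * tri k + 5 * k) / qPoch (p ^ 9) (p ^ 9) k)
  have e : p ^ (6 * tri k + 5 * k) / qPoch (p ^ 9) (p ^ 9) k * qPochInf (p ^ (2 - 3 * k : ℤ)) (p ^ 3)
      = qPochInf (p ^ 2) (p ^ 3) * phiTerm p k := by
    have e1 : p ^ (6 * tri k + 5 * k) * p ^ (2 * k - 3 * tri k - 3 * k : ℤ)
        = p ^ (3 * k.choose 2 + 4 * k) := by
      rw [← zpow_add₀ hp0, ← zpow_natCast]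
      congr 1
      push_cast
      rw [tri_natCast]
      ring
    rw [qPochInf_zpow_sub hp0 hp, phiTerm, ← e1]
    ring
  rw [e] at h
  refine h.congr_fun fun m => ?_
  have e2 : p ^ pairExp k m
      = p ^ (6 * tri k + 5 * k) * ((p ^ 3) ^ m.choose 2 * (p ^ (2 - 3 * k : ℤ)) ^ m) := by
    rw [← pow_mul, ← zpow_natCast p, ← zpow_natCast (p ^ (2 - 3 * k : ℤ)), ← zpow_mul,
      ← zpow_add₀ hp0, ← zpow_add₀ hp0, pairExp, tri_natCast m]
    congr 1
    push_cast
    ring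
  simp only [pairTerm, e2]
  ring

theorem hasSum_pairTerm {p : ℂ} (hp0 : p ≠ 0) (hp : ‖p‖ < 1) :
    HasSum (pairTerm p) (qPochInf (p ^ 2) (p ^ 3) * ∑' k, phiTerm p k) := by
  have hs := (summable_norm_pairTerm hp0 hp).of_norm
  have h1 := hs.hasSum.prod_fiberwise (hasSum_pairTerm_right hp0 hp)
  have h2 := ((summable_norm_phiTerm hp).of_norm.hasSum).mul_left (qPochInf (p ^ 2) (p ^ 3))
  rw [← h1.unique h2]
  exact hs.hasSum

/-! ### The triple series and its cube-root filter -/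

/-- The exponent of `q` in `quadTerm`. -/
def quadExp (x : (ℤ × ℕ) × ℕ) : ℤ :=
  3 * tri (x.2 + 1) + tri x.1.2 + tri (x.1.2 + x.1.1) + 2 * x.1.2 + x.1.1 * x.2

/-- The factor depending only on `q = p³` in the general term of the triple series. -/
noncomputable def quadTerm (q : ℂ) (x : (ℤ × ℕ) × ℕ) : ℂ :=
  (-1) ^ (x.2 + x.1.1 : ℤ) * q ^ quadExp x /
    (qPoch (q ^ 3) (q ^ 3) x.2 * qPoch q q x.1.2)

/-- The map `((M, m), k) ↦ (M + m + k, (k, m))`. -/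
def tripleEquiv : (ℤ × ℕ) × ℕ ≃ ℤ × (ℕ × ℕ) where
  toFun x := (x.1.1 + x.1.2 + x.2, (x.2, x.1.2))
  invFun y := ((y.1 - y.2.2 - y.2.1, y.2.2), y.2.1)
  left_inv x := by ext <;> (simp; try ring)
  right_inv y := by ext <;> (simp; try ring)

/-- The mk term of tri (M + m + k), in base p³, cancels the cross term of `pairExp`. The linear
terms then become 9k and 6m, so p^(4M) is the only power not expressed through p³. -/
theorem thetaTerm_mul_pairTerm {p : ℂ} (hp0 : p ≠ 0) (x : (ℤ × ℕ) × ℕ) :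
    thetaTerm (p ^ 3) (p ^ 4) (tripleEquiv x).1 * pairTerm p (tripleEquiv x).2
      = quadTerm (p ^ 3) x * (p ^ 4) ^ x.1.1 := by
  obtain ⟨⟨M, m⟩, k⟩ := x
  simp only [tripleEquiv, Equiv.coe_fn_mk, thetaTerm, pairTerm, quadTerm]
  have e1 : ((-1 : ℂ)) ^ (M + m + k) * (-1) ^ m = (-1) ^ (k + M : ℤ) := by
    rw [zpow_add₀ (by norm_num), zpow_add₀ (by norm_num), zpow_add₀ (by norm_num)]
    have : ((-1 : ℂ)) ^ m * (-1) ^ m = 1 := by rw [← mul_pow]; norm_num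
    simp only [zpow_natCast]
    linear_combination (-1) ^ M * (-1) ^ k * this
  have e2 : (p ^ 3) ^ tri (M + m + k) * (p ^ 4) ^ (M + m + k) * p ^ pairExp k m
      = (p ^ 3) ^ quadExp ((M, m), k) * (p ^ 4) ^ M := by
    simp only [← zpow_natCast p, ← zpow_mul]
    simp only [← zpow_add₀ hp0]
    congr 1
    simp only [quadExp, pairExp, tri_add, show tri 1 = 0 from rfl]
    push_cast
    linarith [two_mul_tri k, two_mul_tri m]
  rw [← e1, ← pow_mul]
  calc _ = (-1) ^ (M + m + k) * (-1) ^ m *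
        ((p ^ 3) ^ tri (M + m + k) * (p ^ 4) ^ (M + m + k) * p ^ pairExp k m) /
          (qPoch (p ^ 9) (p ^ 9) k * qPoch (p ^ 3) (p ^ 3) m) := by ring
    _ = _ := by rw [e2]; ring

/-- The sum of the triple series. -/
noncomputable def tripleSum (p : ℂ) : ℂ :=
  -p⁻¹ * qPochInf p p * (qPochInf (p ^ 2) (p ^ 3) * ∑' k, phiTerm p k)

theorem hasSum_quadTerm {p : ℂ} (hp0 : p ≠ 0) (hp : ‖p‖ < 1) :
    HasSum (fun x : (ℤ × ℕ) × ℕ => quadTerm (p ^ 3) x * (p ^ 4) ^ x.1.1) (tripleSum p) := by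
  have h3 : ‖p ^ 3‖ < 1 := norm_pow_lt_one hp (by norm_num)
  have h := HasSum.mul_of_summable_norm (hasSum_thetaTerm_cube_fourth hp0 hp)
    (hasSum_pairTerm hp0 hp) (summable_norm_thetaTerm (pow_ne_zero 3 hp0) h3 _)
    (summable_norm_pairTerm hp0 hp)
  exact (tripleEquiv.hasSum_iff.mpr h).congr_fun fun x => (thetaTerm_mul_pairTerm hp0 x).symm

theorem norm_eq_one_of_root {ω : ℂ} (hω : ω ^ 2 + ω + 1 = 0) : ‖ω‖ = 1 := by
  have h3 : ω ^ 3 = 1 := by linear_combination (ω - 1) * hω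
  have := congrArg norm h3
  rw [norm_pow, norm_one] at this
  exact (pow_eq_one_iff_of_nonneg (norm_nonneg _) (by norm_num)).mp this

/-- Roots-of-unity filter: ω⁴ = ω, so the three terms carry the weights 1, ω^M, ω^(2M). -/
theorem sum_zpow_root {p ω : ℂ} (hω : ω ^ 2 + ω + 1 = 0) (M : ℤ) :
    (p ^ 4) ^ M + ((ω * p) ^ 4) ^ M + ((ω ^ 2 * p) ^ 4) ^ M
      = if (3 : ℤ) ∣ M then 3 * (p ^ 4) ^ M else 0 := by
  have h3 : ω ^ 3 = 1 := by linear_combination (ω - 1) * hω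
  have hω0 : ω ≠ 0 := fun h => by simp [h] at h3
  have e1 : (ω * p) ^ 4 = ω * p ^ 4 := by linear_combination ω * p ^ 4 * h3
  have e2 : (ω ^ 2 * p) ^ 4 = ω ^ 2 * p ^ 4 := by
    linear_combination (ω ^ 5 + ω ^ 2) * p ^ 4 * h3
  rw [e1, e2, mul_zpow, mul_zpow]
  obtain ⟨n, r, hM, hr⟩ : ∃ n : ℤ, ∃ r : ℕ, M = 3 * n + r ∧ r < 3 :=
    ⟨M / 3, (M % 3).toNat, by omega, by omega⟩
  have h4 : ω ^ M = ω ^ r := by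
    rw [hM, zpow_add₀ hω0, zpow_mul, zpow_natCast]
    have : ω ^ (3 : ℤ) = 1 := by exact_mod_cast h3
    rw [this, one_zpow, one_mul]
  have h5 : (ω ^ 2) ^ M = (ω ^ r) ^ 2 := by
    rw [← zpow_natCast, ← zpow_mul, mul_comm, zpow_mul, h4]
    norm_cast
  rw [h4, h5]
  interval_cases r
  · rw [if_pos (by omega)]; ring
  · rw [if_neg (by omega)]; linear_combination (p ^ 4) ^ M * hω
  · rw [if_neg (by omega)]; linear_combination (p ^ 4) ^ M * hω + ω * (p ^ 4) ^ M * h3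

theorem hasSum_quadTerm_dvd {p ω : ℂ} (hω : ω ^ 2 + ω + 1 = 0) (hp0 : p ≠ 0) (hp : ‖p‖ < 1) :
    HasSum (fun x : (ℤ × ℕ) × ℕ =>
        quadTerm (p ^ 3) ((3 * x.1.1, x.1.2), x.2) * (3 * ((p ^ 3) ^ 4) ^ x.1.1))
      (tripleSum p + tripleSum (ω * p) + tripleSum (ω ^ 2 * p)) := by
  have h3 : ω ^ 3 = 1 := by linear_combination (ω - 1) * hω
  have hω0 : ω ≠ 0 := fun h => by simp [h] at h3
  have hωn := norm_eq_one_of_root hω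
  have s1 := hasSum_quadTerm hp0 hp
  have s2 := hasSum_quadTerm (p := ω * p) (mul_ne_zero hω0 hp0) (by simpa [hωn] using hp)
  have s3 := hasSum_quadTerm (p := ω ^ 2 * p) (mul_ne_zero (pow_ne_zero 2 hω0) hp0)
    (by simpa [hωn] using hp)
  rw [show (ω * p) ^ 3 = p ^ 3 by linear_combination p ^ 3 * h3] at s2
  rw [show (ω ^ 2 * p) ^ 3 = p ^ 3 by linear_combination (ω ^ 3 + 1) * p ^ 3 * h3] at s3
  have h := (s1.add s2).add s3
  let f : (ℤ × ℕ) × ℕ → (ℤ × ℕ) × ℕ := fun x => ((3 * x.1.1, x.1.2), x.2)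
  have hf : Function.Injective f := fun x y hxy => by
    simp only [f, Prod.mk.injEq] at hxy
    ext <;> omega
  have h' : HasSum (fun x : (ℤ × ℕ) × ℕ =>
      quadTerm (p ^ 3) x * (if (3 : ℤ) ∣ x.1.1 then 3 * (p ^ 4) ^ x.1.1 else 0))
      (tripleSum p + tripleSum (ω * p) + tripleSum (ω ^ 2 * p)) :=
    h.congr_fun fun x => by rw [← sum_zpow_root hω]; ring
  have hzero : ∀ x : (ℤ × ℕ) × ℕ, x ∉ Set.range f →
      quadTerm (p ^ 3) x * (if (3 : ℤ) ∣ x.1.1 then 3 * (p ^ 4) ^ x.1.1 else 0) = 0 := by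
    intro x hx
    rw [if_neg, mul_zero]
    rintro ⟨n, hn⟩
    exact hx ⟨((n, x.1.2), x.2), by simp [f, ← hn]⟩
  refine (hf.hasSum_iff hzero |>.mpr h').congr_fun fun x => ?_
  simp only [Function.comp, f, if_pos (dvd_mul_right (3 : ℤ) x.1.1), zpow_mul]
  congr 3
  norm_cast
  ring

/-- With M = 3n the part of the exponent involving k is 3 tri k + 3(n+1)k, which is Euler's series
in base q³. The rest is already the exponent of the target series. -/
theorem hasSum_quadTerm_right {q : ℂ} (hq0 : q ≠ 0) (hq : ‖q‖ < 1) (n : ℤ) (m : ℕ) :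
    HasSum (fun k : ℕ => quadTerm q ((3 * n, m), k) * (3 * (q ^ 4) ^ n))
      (3 * ((-1) ^ n * q ^ (2 * tri m + 9 * tri n + 3 * n * m + 2 * m + 7 * n) / qPoch q q m *
        qPochInf ((q ^ 3) ^ (n + 1)) (q ^ 3))) := by
  have h3 : ‖q ^ 3‖ < 1 := norm_pow_lt_one hq (by norm_num)
  have h := ((hasSum_euler h3 ((q ^ 3) ^ (n + 1))).mul_left
    ((-1) ^ n * q ^ (2 * tri m + 9 * tri n + 3 * n * m + 2 * m + 7 * n) / qPoch q q m)).mul_left 3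
  refine h.congr_fun fun k => ?_
  have e1 : (-1 : ℂ) ^ (k + 3 * n : ℤ) = (-1) ^ n * (-1) ^ k := by
    rw [zpow_add₀ (by norm_num), zpow_mul, zpow_natCast, mul_comm]
    norm_num
  have e2 : q ^ quadExp ((3 * n, m), k) * (q ^ 4) ^ n
      = q ^ (2 * tri m + 9 * tri n + 3 * n * m + 2 * m + 7 * n) *
        ((q ^ 3) ^ k.choose 2 * ((q ^ 3) ^ (n + 1)) ^ k) := by
    rw [← zpow_tri_natCast]
    simp only [← zpow_natCast, ← zpow_mul, ← zpow_add₀ hq0]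
    congr 1
    simp only [quadExp, tri_add, show tri 1 = 0 from rfl]
    push_cast
    linarith [two_mul_tri (3 * n), two_mul_tri n]
  simp only [quadTerm, e1]
  linear_combination 3 * ((-1) ^ n * (-1) ^ k / (qPoch (q ^ 3) (q ^ 3) k * qPoch q q m)) * e2

/-- The double series, multiplied by `3 (q³;q³)_∞`, as a trisection of `tripleSum`. -/
theorem hasSum_doubleSeries {p ω : ℂ} (hω : ω ^ 2 + ω + 1 = 0) (hp0 : p ≠ 0) (hp : ‖p‖ < 1)
    {q : ℂ} (hpq : p ^ 3 = q) :
    HasSum (fun x : ℕ × ℕ => 3 * qPochInf (q ^ 3) (q ^ 3) * ((-1 : ℂ) ^ x.2 *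
        q ^ (2 * Nat.choose x.1 2 + 9 * Nat.choose x.2 2 + 3 * x.1 * x.2 + 2 * x.1 + 7 * x.2) /
          (qPoch q q x.1 * qPoch (q ^ 3) (q ^ 3) x.2)))
      (tripleSum p + tripleSum (ω * p) + tripleSum (ω ^ 2 * p)) := by
  have hq : ‖q‖ < 1 := hpq ▸ norm_pow_lt_one hp (by norm_num)
  have hq0 : q ≠ 0 := hpq ▸ pow_ne_zero 3 hp0
  have h3 : ‖q ^ 3‖ < 1 := norm_pow_lt_one hq (by norm_num)
  have h := hasSum_quadTerm_dvd hω hp0 hp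
  rw [hpq] at h
  have h1 := h.prod_fiberwise fun x => hasSum_quadTerm_right hq0 hq x.1 x.2
  let f : ℕ × ℕ → ℤ × ℕ := fun x => (x.2, x.1)
  have hf : Function.Injective f := fun x y hxy => by
    simp only [f, Prod.mk.injEq, Nat.cast_inj] at hxy
    ext
    · exact hxy.2
    · exact hxy.1
  refine (hf.hasSum_iff (fun x hx => ?_) |>.mpr h1).congr_fun fun x => ?_
  -- Negative n contribute nothing: (q^(3n+3);q³)_∞ then contains the factor 1 - 1.
  · rw [qPochInf_zpow_eq_zero (pow_ne_zero 3 hq0), mul_zero, mul_zero]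
    by_contra! hn
    exact hx ⟨(x.2, x.1.toNat), Prod.ext (Int.toNat_of_nonneg (by omega)) rfl⟩
  · obtain ⟨m, n⟩ := x
    have e1 := qPoch_mul_qPochInf (q ^ 3) h3 n
    have e2 := qPoch_ne_zero_of_norm_lt h3 h3 n
    have e3 : (q ^ 3) ^ ((n : ℤ) + 1) = q ^ 3 * (q ^ 3) ^ n := by
      rw [zpow_add₀ (pow_ne_zero 3 hq0), zpow_one, zpow_natCast, mul_comm]
    have e4 : q ^ (2 * tri m + 9 * tri n + 3 * n * m + 2 * m + 7 * n)
        = q ^ (2 * Nat.choose m 2 + 9 * Nat.choose n 2 + 3 * m * n + 2 * m + 7 * n) := by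
      rw [← zpow_natCast]
      congr 1
      push_cast
      rw [tri_natCast, tri_natCast]
      ring
    simp only [Function.comp, f, e3, e4, ← e1, zpow_natCast]
    field_simp

/-! ### Gauss's double theta series and its trisection -/

theorem qPochInf_mul_neg (A : ℂ) {q : ℂ} (hq : ‖q‖ < 1) :
    qPochInf A q * qPochInf (-A) q = qPochInf (A ^ 2) (q ^ 2) := by
  rw [qPochInf, qPochInf, qPochInf,
    ← (multipliable_qPoch A hq).tprod_mul (multipliable_qPoch (-A) hq)]
  exact tprod_congr fun k => by ring

/-- The general term of the double theta series for `(p;p)_∞ (p²;p²)_∞`. -/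
noncomputable def gaussTerm (p : ℂ) (x : ℤ × ℤ) : ℂ :=
  (-1) ^ x.1 * p ^ (x.1 ^ 2 + tri x.2)

/-- Product of the triple products in base p² at z = p and in base p at z = -1, simplified by
Euler's identity (p;p²)_∞ (-p;p)_∞ = 1. The 2 is the first factor of (-1;p)_∞. -/
theorem hasSum_gaussTerm {p : ℂ} (hp0 : p ≠ 0) (hp : ‖p‖ < 1) :
    HasSum (gaussTerm p) (2 * (qPochInf p p * qPochInf (p ^ 2) (p ^ 2))) := by
  have h2 : ‖p ^ 2‖ < 1 := norm_pow_lt_one hp (by norm_num)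
  have s1 := hasSum_thetaTerm (z := p) (pow_ne_zero 2 hp0) h2 (by
    rw [norm_pow]
    exact pow_lt_self_of_lt_one₀ (norm_pos_iff.mpr hp0) hp (by norm_num))
  have s2 := hasSum_thetaTerm (z := -1) hp0 hp (by simpa using hp)
  have h := HasSum.mul_of_summable_norm s1 s2
    (summable_norm_thetaTerm (pow_ne_zero 2 hp0) h2 _) (summable_norm_thetaTerm hp0 hp _)
  have e1 : p ^ 2 / p = p := by field_simp
  have e2 : p / -1 = -p := by ring
  have e3 : qPochInf (-1) p = 2 * qPochInf (-p) p := by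
    rw [← one_sub_mul_qPochInf (-1) hp]
    ring_nf
  have e4 : qPochInf p (p ^ 2) * qPochInf (-p) p = 1 := by
    have e5 := qPochInf_mul_neg p hp
    have e6 := qPochInf_sq p hp
    rw [← e6, show p * p = p ^ 2 by ring] at e5
    exact mul_right_cancel₀ (qPochInf_ne_zero_of_norm_lt h2 h2) (by linear_combination e5)
  rw [e1, e2, e3] at h
  have e7 : 2 * (qPochInf p p * qPochInf (p ^ 2) (p ^ 2))
      = qPochInf (p ^ 2) (p ^ 2) * qPochInf p (p ^ 2) * qPochInf p (p ^ 2) *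
        (qPochInf p p * (2 * qPochInf (-p) p) * qPochInf (-p) p) := by
    linear_combination (-2 * (qPochInf p p * qPochInf (p ^ 2) (p ^ 2)) *
      (qPochInf p (p ^ 2) * qPochInf (-p) p + 1)) * e4
  rw [e7]
  refine h.congr_fun fun x => ?_
  have e8 : ((-1 : ℂ)) ^ x.2 * (-1) ^ x.2 = 1 := by rw [← mul_zpow]; simp
  have e9 : p ^ (x.1 ^ 2 + tri x.2) = (p ^ 2) ^ tri x.1 * p ^ x.1 * p ^ tri x.2 := by
    rw [← zpow_natCast, ← zpow_mul, ← zpow_add₀ hp0, ← zpow_add₀ hp0]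
    congr 1
    push_cast
    linarith [two_mul_tri x.1]
  rw [gaussTerm, thetaTerm, thetaTerm, e9]
  linear_combination (-((-1) ^ x.1 * ((p ^ 2) ^ tri x.1 * p ^ x.1 * p ^ tri x.2))) * e8

/-- The involution `i ↦ 2c + 1 - i` on each line `i + j = 3c + 2` reverses signs. -/
theorem hasSum_gaussTerm_line {p : ℂ} (hp0 : p ≠ 0) (hp : ‖p‖ < 1) :
    HasSum (fun x : ℤ × ℤ => if (3 : ℤ) ∣ x.1 + x.2 - 2 then gaussTerm p x else 0) 0 := by
  let f : ℤ × ℤ → ℤ × ℤ := fun y => (y.2, 3 * y.1 + 2 - y.2)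
  have hf : Function.Injective f := fun x y hxy => by
    simp only [f, Prod.mk.injEq] at hxy
    ext <;> omega
  refine (hf.hasSum_iff fun x hx => if_neg ?_).mp ?_
  · rintro ⟨c, hc⟩
    exact hx ⟨(c, x.1), Prod.ext rfl (by simp only [f]; omega)⟩
  have hs : Summable fun y => gaussTerm p (f y) :=
    (hasSum_gaussTerm hp0 hp).summable.comp_injective hf
  let σ : ℤ × ℤ ≃ ℤ × ℤ :=
    { toFun := fun y => (y.1, 2 * y.1 + 1 - y.2)
      invFun := fun y => (y.1, 2 * y.1 + 1 - y.2)
      left_inv := fun y => by ext <;> simp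
      right_inv := fun y => by ext <;> simp }
  have hσ : ∀ y, gaussTerm p (f (σ y)) = -gaussTerm p (f y) := fun y => by
    have e1 : ((-1 : ℂ)) ^ (2 * y.1 + 1 - y.2) = -(-1) ^ y.2 := by
      rw [zpow_sub₀ (by norm_num), zpow_add₀ (by norm_num), zpow_mul, zpow_one]
      rcases Int.even_or_odd y.2 with h | h <;> simp [h.neg_one_zpow]
    -- On the line indexed by c, the exponent is a quadratic in i symmetric about c + 1/2, while the
    -- reflection changes the parity of i.
    have e2 : (2 * y.1 + 1 - y.2) ^ 2 + tri (3 * y.1 + 2 - (2 * y.1 + 1 - y.2))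
        = y.2 ^ 2 + tri (3 * y.1 + 2 - y.2) := by
      linarith [two_mul_tri (3 * y.1 + 2 - (2 * y.1 + 1 - y.2)),
        two_mul_tri (3 * y.1 + 2 - y.2)]
    simp only [gaussTerm, f, σ, Equiv.coe_fn_mk, e1, e2, neg_mul]
  have h1 : ∑' y, gaussTerm p (f y) = -∑' y, gaussTerm p (f y) := by
    conv_lhs => rw [← σ.tsum_eq]
    simp only [hσ, tsum_neg]
  have h2 : ∑' y, gaussTerm p (f y) = 0 := self_eq_neg.mp h1
  rw [← h2]
  refine hs.hasSum.congr_fun fun y => ?_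
  rw [Function.comp, if_pos]
  exact ⟨y.1, by simp only [f]; ring⟩

theorem hasSum_gaussTerm_line_neg {p : ℂ} (hp0 : p ≠ 0) (hp : ‖p‖ < 1) :
    HasSum (fun x : ℤ × ℤ => if (3 : ℤ) ∣ x.1 - x.2 - 1 then gaussTerm p x else 0) 0 := by
  have h := ((Equiv.neg ℤ).prodCongr (Equiv.refl ℤ)).hasSum_iff.mpr (hasSum_gaussTerm_line hp0 hp)
  refine h.congr_fun fun x => ?_
  have e : gaussTerm p (-x.1, x.2) = gaussTerm p x := by
    rcases Int.even_or_odd x.1 with h | h <;> simp [gaussTerm, h.neg_one_zpow]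
  have e' : (3 : ℤ) ∣ -x.1 + x.2 - 2 ↔ (3 : ℤ) ∣ x.1 - x.2 - 1 := by omega
  change _ = if (3 : ℤ) ∣ -x.1 + x.2 - 2 then gaussTerm p (-x.1, x.2) else 0
  simp only [e, e']

/-- For i = 3a, j = 3b - 1 the exponent is 9(a² + tri b) + 1, a copy of the whole series in base p⁹.
-/
theorem hasSum_gaussTerm_sublattice {p : ℂ} (hp0 : p ≠ 0) (hp : ‖p‖ < 1) :
    HasSum (fun x : ℤ × ℤ => if (3 : ℤ) ∣ x.1 ∧ (3 : ℤ) ∣ x.2 + 1 then gaussTerm p x else 0)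
      (p * (2 * (qPochInf (p ^ 9) (p ^ 9) * qPochInf (p ^ 18) (p ^ 18)))) := by
  let f : ℤ × ℤ → ℤ × ℤ := fun y => (3 * y.1, 3 * y.2 - 1)
  have hf : Function.Injective f := fun x y hxy => by
    simp only [f, Prod.mk.injEq] at hxy
    ext <;> omega
  refine (hf.hasSum_iff fun x hx => if_neg ?_).mp ?_
  · rintro ⟨⟨a, ha⟩, b, hb⟩
    exact hx ⟨(a, b), Prod.ext ha.symm (by simp only [f]; omega)⟩
  have h := (hasSum_gaussTerm (pow_ne_zero 9 hp0)
    (norm_pow_lt_one hp (by norm_num))).mul_left p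
  rw [← pow_mul] at h
  refine h.congr_fun fun y => ?_
  have e1 : ((-1 : ℂ)) ^ (3 * y.1) = (-1) ^ y.1 := by
    rw [zpow_mul]
    norm_num
  have e2 : p ^ ((3 * y.1) ^ 2 + tri (3 * y.2 - 1)) = p * (p ^ 9) ^ (y.1 ^ 2 + tri y.2) := by
    rw [← zpow_natCast, ← zpow_mul, ← zpow_one_add₀ hp0]
    congr 1
    push_cast
    linarith [two_mul_tri (3 * y.2 - 1), two_mul_tri y.2]
  rw [Function.comp, if_pos ⟨⟨y.1, rfl⟩, y.2, by simp only [f]; ring⟩]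
  simp only [gaussTerm, f, e1, e2]
  ring

theorem three_dvd_sq_add_tri_sub_one (i j : ℤ) :
    ((3 : ℤ) ∣ i ^ 2 + tri j - 1) ↔ ((3 : ℤ) ∣ i + j - 2 ∨ (3 : ℤ) ∣ i - j - 1) := by
  obtain ⟨a, r, hi, hr0, hr⟩ : ∃ a r : ℤ, i = 3 * a + r ∧ 0 ≤ r ∧ r < 3 :=
    ⟨i / 3, i % 3, by omega, by omega, by omega⟩
  obtain ⟨b, s, hj, hs0, hs⟩ : ∃ b s : ℤ, j = 3 * b + s ∧ 0 ≤ s ∧ s < 3 :=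
    ⟨j / 3, j % 3, by omega, by omega, by omega⟩
  have e1 : i ^ 2 = 3 * (3 * a ^ 2 + 2 * a * r) + r ^ 2 := by rw [hi]; ring
  have e2 : tri j = 3 * (3 * tri b + b + b * s) + tri s := by
    rw [hj, tri_add]
    linarith [two_mul_tri (3 * b), two_mul_tri b]
  rw [e1, e2, hi, hj]
  generalize 3 * a ^ 2 + 2 * a * r = u
  generalize 3 * tri b + b + b * s = v
  have t0 : tri 0 = 0 := rfl
  have t1 : tri 1 = 0 := rfl
  have t2 : tri 2 = 1 := rfl
  interval_cases r <;> interval_cases s <;> simp only [t0, t1, t2] <;> omega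

/-- The prefactor p⁻¹ makes the cube-root filter select exponents congruent to 1 mod 3. These form a
union of two congruence classes, written by inclusion-exclusion. -/
theorem sum_inv_mul_gaussTerm {p ω : ℂ} (hω : ω ^ 2 + ω + 1 = 0) (x : ℤ × ℤ) :
    p⁻¹ * gaussTerm p x + (ω * p)⁻¹ * gaussTerm (ω * p) x
        + (ω ^ 2 * p)⁻¹ * gaussTerm (ω ^ 2 * p) x
      = 3 * p⁻¹ * ((if (3 : ℤ) ∣ x.1 + x.2 - 2 then gaussTerm p x else 0)
        + (if (3 : ℤ) ∣ x.1 - x.2 - 1 then gaussTerm p x else 0)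
        - (if (3 : ℤ) ∣ x.1 ∧ (3 : ℤ) ∣ x.2 + 1 then gaussTerm p x else 0)) := by
  have h3 : ω ^ 3 = 1 := by linear_combination (ω - 1) * hω
  have hω0 : ω ≠ 0 := fun h => by simp [h] at h3
  have key : ∀ c : ℂ, c ≠ 0 → (c * p)⁻¹ * gaussTerm (c * p) x
      = c ^ (x.1 ^ 2 + tri x.2 - 1) * (p⁻¹ * gaussTerm p x) := fun c hc => by
    rw [gaussTerm, gaussTerm, mul_zpow, zpow_sub_one₀ hc, mul_inv]
    ring
  have hA := three_dvd_sq_add_tri_sub_one x.1 x.2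
  rw [key ω hω0, key (ω ^ 2) (pow_ne_zero 2 hω0)]
  obtain ⟨n, r, hM, hr⟩ : ∃ n : ℤ, ∃ r : ℕ, x.1 ^ 2 + tri x.2 - 1 = 3 * n + r ∧ r < 3 :=
    ⟨(x.1 ^ 2 + tri x.2 - 1) / 3, ((x.1 ^ 2 + tri x.2 - 1) % 3).toNat, by omega, by omega⟩
  rw [hM] at hA ⊢
  have h4 : ω ^ (3 * n + r) = ω ^ r := by
    rw [zpow_add₀ hω0, zpow_mul, zpow_natCast]
    have : ω ^ (3 : ℤ) = 1 := by exact_mod_cast h3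
    rw [this, one_zpow, one_mul]
  have h5 : (ω ^ 2) ^ (3 * n + r) = (ω ^ r) ^ 2 := by
    rw [← zpow_natCast, ← zpow_mul, mul_comm, zpow_mul, h4]
    norm_cast
  rw [h4, h5]
  have hsplit : ((if (3 : ℤ) ∣ x.1 + x.2 - 2 then gaussTerm p x else 0)
        + (if (3 : ℤ) ∣ x.1 - x.2 - 1 then gaussTerm p x else 0)
        - (if (3 : ℤ) ∣ x.1 ∧ (3 : ℤ) ∣ x.2 + 1 then gaussTerm p x else 0))
      = if (3 : ℤ) ∣ 3 * n + r then gaussTerm p x else 0 := by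
    simp only [hA]
    have hAB : ((3 : ℤ) ∣ x.1 ∧ (3 : ℤ) ∣ x.2 + 1)
        ↔ ((3 : ℤ) ∣ x.1 + x.2 - 2 ∧ (3 : ℤ) ∣ x.1 - x.2 - 1) := by omega
    simp only [hAB]
    by_cases h1 : (3 : ℤ) ∣ x.1 + x.2 - 2 <;> by_cases h2 : (3 : ℤ) ∣ x.1 - x.2 - 1 <;>
      simp [h1, h2]
  rw [hsplit]
  interval_cases r
  · rw [if_pos (by omega)]; ring
  · rw [if_neg (by omega)]; linear_combination (p⁻¹ * gaussTerm p x) * hω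
  · rw [if_neg (by omega)]
    linear_combination (p⁻¹ * gaussTerm p x) * hω + ω * (p⁻¹ * gaussTerm p x) * h3

/-- A trisection of `p⁻¹ (p;p)_∞ (p²;p²)_∞`. -/
theorem trisection {p ω : ℂ} (hω : ω ^ 2 + ω + 1 = 0) (hp0 : p ≠ 0) (hp : ‖p‖ < 1) :
    p⁻¹ * (qPochInf p p * qPochInf (p ^ 2) (p ^ 2))
      + (ω * p)⁻¹ * (qPochInf (ω * p) (ω * p) * qPochInf ((ω * p) ^ 2) ((ω * p) ^ 2))
      + (ω ^ 2 * p)⁻¹ *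
        (qPochInf (ω ^ 2 * p) (ω ^ 2 * p) * qPochInf ((ω ^ 2 * p) ^ 2) ((ω ^ 2 * p) ^ 2))
      = -3 * (qPochInf (p ^ 9) (p ^ 9) * qPochInf (p ^ 18) (p ^ 18)) := by
  have hωn := norm_eq_one_of_root hω
  have hω0 : ω ≠ 0 := norm_pos_iff.mp (by rw [hωn]; exact one_pos)
  have s1 := (hasSum_gaussTerm hp0 hp).mul_left p⁻¹
  have s2 := (hasSum_gaussTerm (p := ω * p) (mul_ne_zero hω0 hp0)
    (by simpa [hωn] using hp)).mul_left (ω * p)⁻¹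
  have s3 := (hasSum_gaussTerm (p := ω ^ 2 * p) (mul_ne_zero (pow_ne_zero 2 hω0) hp0)
    (by simpa [hωn] using hp)).mul_left (ω ^ 2 * p)⁻¹
  have hr := (((hasSum_gaussTerm_line hp0 hp).add (hasSum_gaussTerm_line_neg hp0 hp)).sub
    (hasSum_gaussTerm_sublattice hp0 hp)).mul_left (3 * p⁻¹)
  have h := ((s1.add s2).add s3).unique (hr.congr_fun (sum_inv_mul_gaussTerm hω))
  field_simp at h ⊢
  linear_combination h / 2

/-! ### Assembly -/

/-- Splitting (p²;p³)_∞ and (p²;p²)_∞ into base p⁶ cancels the products from `tsum_phiTerm`. What is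
not a function of q gathers in p⁻¹ (p;p)_∞ (p²;p²)_∞, the expression that `trisection` sums. -/
theorem tripleSum_mul {p : ℂ} (hp0 : p ≠ 0) (hp : ‖p‖ < 1) {q : ℂ} (hpq : p ^ 3 = q) :
    tripleSum p * (qPochInf (q ^ 3) (q ^ 6) * qPochInf (q ^ 2) (q ^ 2))
      = -(p⁻¹ * (qPochInf p p * qPochInf (p ^ 2) (p ^ 2))) * qPochInf (q ^ 4) (q ^ 6) := by
  have hn : ∀ n : ℕ, n ≠ 0 → ‖p ^ n‖ < 1 := fun n hn => norm_pow_lt_one hp hn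
  have h1 := tsum_phiTerm hp0 hp
  have h2 := qPochInf_sq (p ^ 2) (hn 3 (by norm_num))
  have h3 := qPochInf_cube (p ^ 2) (hn 2 (by norm_num))
  rw [show (p ^ 3) ^ 2 = p ^ 6 by ring, show p ^ 2 * p ^ 3 = p ^ 5 by ring] at h2
  rw [show (p ^ 2) ^ 3 = p ^ 6 by ring, show p ^ 2 * p ^ 2 = p ^ 4 by ring,
    show p ^ 2 * (p ^ 2) ^ 2 = p ^ 6 by ring] at h3
  rw [tripleSum, ← hpq, show (p ^ 3) ^ 3 = p ^ 9 by ring, show (p ^ 3) ^ 6 = p ^ 18 by ring,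
    show (p ^ 3) ^ 2 = p ^ 6 by ring, show (p ^ 3) ^ 4 = p ^ 12 by ring, ← h2, ← h3]
  linear_combination (-p⁻¹ * qPochInf p p * qPochInf (p ^ 2) (p ^ 6) * qPochInf (p ^ 6) (p ^ 6)) * h1

theorem tripleSum_add {p ω : ℂ} (hω : ω ^ 2 + ω + 1 = 0) (hp0 : p ≠ 0) (hp : ‖p‖ < 1)
    {q : ℂ} (hpq : p ^ 3 = q) :
    tripleSum p + tripleSum (ω * p) + tripleSum (ω ^ 2 * p)
      = 3 * qPochInf (q ^ 3) (q ^ 3) * (1 / qPochInf₂ (q ^ 2) (q ^ 3) (q ^ 6)) := by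
  have hq : ‖q‖ < 1 := hpq ▸ norm_pow_lt_one hp (by norm_num)
  have hn : ∀ n : ℕ, n ≠ 0 → ‖q ^ n‖ < 1 := fun n hn => norm_pow_lt_one hq hn
  have h3 : ω ^ 3 = 1 := by linear_combination (ω - 1) * hω
  have hωn := norm_eq_one_of_root hω
  have hω0 : ω ≠ 0 := norm_pos_iff.mp (by rw [hωn]; exact one_pos)
  have t1 := tripleSum_mul hp0 hp hpq
  have t2 := tripleSum_mul (p := ω * p) (mul_ne_zero hω0 hp0) (by simpa [hωn] using hp) (q := q)
    (by rw [← hpq]; linear_combination p ^ 3 * h3)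
  have t3 := tripleSum_mul (p := ω ^ 2 * p) (mul_ne_zero (pow_ne_zero 2 hω0) hp0)
    (by simpa [hωn] using hp) (q := q)
    (by rw [← hpq]; linear_combination (ω ^ 3 + 1) * p ^ 3 * h3)
  have t := trisection hω hp0 hp
  have hc := qPochInf_cube (q ^ 2) (hn 2 (by norm_num))
  rw [show (q ^ 2) ^ 3 = q ^ 6 by ring, show q ^ 2 * q ^ 2 = q ^ 4 by ring,
    show q ^ 2 * (q ^ 2) ^ 2 = q ^ 6 by ring] at hc
  rw [show p ^ 9 = q ^ 3 by rw [← hpq]; ring, show p ^ 18 = q ^ 6 by rw [← hpq]; ring] at t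
  have n0 : ∀ a b : ℕ, a ≠ 0 → b ≠ 0 → qPochInf (q ^ a) (q ^ b) ≠ 0 := fun a b ha hb =>
    qPochInf_ne_zero_of_norm_lt (hn a ha) (hn b hb)
  have n1 := n0 2 6 (by norm_num) (by norm_num)
  have n2 := n0 3 6 (by norm_num) (by norm_num)
  have n3 := n0 4 6 (by norm_num) (by norm_num)
  have n4 := n0 6 6 (by norm_num) (by norm_num)
  have main : (tripleSum p + tripleSum (ω * p) + tripleSum (ω ^ 2 * p)) *
      (qPochInf (q ^ 3) (q ^ 6) * qPochInf (q ^ 2) (q ^ 2))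
      = 3 * (qPochInf (q ^ 3) (q ^ 3) * qPochInf (q ^ 6) (q ^ 6)) * qPochInf (q ^ 4) (q ^ 6) := by
    linear_combination t1 + t2 + t3 - qPochInf (q ^ 4) (q ^ 6) * t
  rw [← hc] at main
  rw [qPochInf₂, mul_one_div, eq_div_iff (mul_ne_zero n1 n2)]
  exact mul_right_cancel₀ (mul_ne_zero n3 n4) (by linear_combination main)

theorem exists_root_sq_add_self_add_one : ∃ ω : ℂ, ω ^ 2 + ω + 1 = 0 := by
  obtain ⟨s, hs⟩ := IsAlgClosed.exists_pow_nat_eq (-3 : ℂ) (n := 2) (by norm_num)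
  exact ⟨(-1 + s) / 2, by linear_combination hs / 4⟩

theorem mainTheorem3 (q : ℂ) (hq : ‖q‖ < 1) :
    Multipliable (fun k : ℕ => 1 - q ^ 2 * (q ^ 6) ^ k) ∧
    Multipliable (fun k : ℕ => 1 - q ^ 3 * (q ^ 6) ^ k) ∧
    qPochInf₂ (q ^ 2) (q ^ 3) (q ^ 6) ≠ 0 ∧
    HasSum
      (fun p : ℕ × ℕ =>
        (-1 : ℂ) ^ p.2 *
            q ^ (2 * Nat.choose p.1 2 + 9 * Nat.choose p.2 2
              + 3 * p.1 * p.2 + 2 * p.1 + 7 * p.2) /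
          (qPoch q q p.1 * qPoch (q ^ 3) (q ^ 3) p.2))
      (1 / qPochInf₂ (q ^ 2) (q ^ 3) (q ^ 6)) := by
  have hn : ∀ n : ℕ, n ≠ 0 → ‖q ^ n‖ < 1 := fun n hn => norm_pow_lt_one hq hn
  have h6 := hn 6 (by norm_num)
  refine ⟨multipliable_qPoch _ h6, multipliable_qPoch _ h6,
    mul_ne_zero (qPochInf_ne_zero_of_norm_lt (hn 2 (by norm_num)) h6)
      (qPochInf_ne_zero_of_norm_lt (hn 3 (by norm_num)) h6), ?_⟩
  -- The case q = 0 is separate because the argument uses negative powers of p; there only the term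
  -- (0, 0) survives.
  rcases eq_or_ne q 0 with rfl | hq0
  · have h := hasSum_single (f := fun p : ℕ × ℕ => (-1 : ℂ) ^ p.2 *
      0 ^ (2 * Nat.choose p.1 2 + 9 * Nat.choose p.2 2 + 3 * p.1 * p.2 + 2 * p.1 + 7 * p.2) /
        (qPoch 0 0 p.1 * qPoch (0 ^ 3) (0 ^ 3) p.2)) (0, 0) (fun p hp => by
      have : 2 * Nat.choose p.1 2 + 9 * Nat.choose p.2 2 + 3 * p.1 * p.2 + 2 * p.1 + 7 * p.2 ≠ 0 :=
        fun h => hp (Prod.ext (by simp only; omega) (by simp only; omega))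
      simp [zero_pow this])
    simpa [qPoch, qPochInf₂, qPochInf] using h
  · obtain ⟨ω, hω⟩ := exists_root_sq_add_self_add_one
    obtain ⟨p, hpq⟩ := IsAlgClosed.exists_pow_nat_eq q (n := 3) (by norm_num)
    have hp0 : p ≠ 0 := fun h => hq0 (by rw [← hpq, h]; norm_num)
    have hp : ‖p‖ < 1 := by
      by_contra! h
      have := one_le_pow₀ h (n := 3)
      rw [← norm_pow, hpq] at this
      linarith
    have h3 := qPochInf_ne_zero_of_norm_lt (hn 3 (by norm_num)) (hn 3 (by norm_num))
    have h := hasSum_doubleSeries hω hp0 hp hpq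
    rw [tripleSum_add hω hp0 hp hpq] at h
    exact (hasSum_mul_left_iff (mul_ne_zero (by norm_num) h3)).mp h
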